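/- **Theorem 1.1.** Let $(M,g)$ be a Kähler manifold of complex dimension $n$, with Kähler form $\omega=\frac{i}{2}\sum g_{\alpha\bar\beta}\,dz_\alpha\wedge d\bar z_\beta$ in local holomorphic coordinates. Assume that: 1. $g$ is *radial*: there is a dense set of points of $M$ around each of which there are holomorphic coordinates $z=(z_1,\dots,z_n)$ (not necessarily centred at the point) in which $\omega=\frac{i}{2}\partial\bar\partial\Phi$ for a smooth real function $\Phi$ of the form $\Phi(z)=f(|z_1|^2+\cdots+|z_n|^2)$; 2. $g$ is Ricci-flat, i.e. $\partial\bar\partial\log\det(g_{\alpha\bar\beta})=0$; 3. $g$ is *stable-projectively induced*: there is $\epsilon>0$ such that for every real $\lambda>0$ with $\lambda\in(1-\epsilon,1+\epsilon)$ the metric $\lambda g$ is projectively induced, that is, there are $N\le\infty$ and a holomorphic map $F:M\to\mathbb{C}P^N$ with $F^*g_{FS}=\lambda g$. Here $\mathbb{C}P^N$ is the projective space of the space of square summable sequences $(Z_0,\dots,Z_N)$ of complex numbers, and $g_{FS}$ is the Fubini–Study metric, with Kähler form $\omega_{FS}=\frac{i}{2}\partial\bar\partial\log(|Z_0|^2+\cdots+|Z_N|^2)$.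 ($N$ and $F$ may depend on $\lambda$.) Then $g$ is flat, i.e. its curvature tensor vanishes identically. -/

import Mathlib

open scoped Manifold ContDiff LinearAlgebra.Projectivization ComplexConjugate

noncomputable section

namespace KahlerGeom

/-- The model space `ℂⁿ`, with `‖z‖ ^ 2 = |z₁|² + ⋯ + |zₙ|²`. -/
abbrev Cn (n : ℕ) : Type := EuclideanSpace ℂ (Fin n)

/-- The `i`-th coordinate vector of `ℂⁿ`. -/
def basisVec {n : ℕ} (i : Fin n) : Cn n := EuclideanSpace.single i (1 : ℂ)

/-- The Wirtinger derivative `∂u/∂zᵢ = (∂u/∂xᵢ - √-1 ∂u/∂yᵢ) / 2`. -/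
def dz {n : ℕ} (i : Fin n) (u : Cn n → ℂ) (z : Cn n) : ℂ :=
  (fderiv ℝ u z (basisVec i) - Complex.I * fderiv ℝ u z (Complex.I • basisVec i)) / 2

/-- The Wirtinger derivative `∂u/∂z̄ᵢ = (∂u/∂xᵢ + √-1 ∂u/∂yᵢ) / 2`. -/
def dzbar {n : ℕ} (i : Fin n) (u : Cn n → ℂ) (z : Cn n) : ℂ :=
  (fderiv ℝ u z (basisVec i) + Complex.I * fderiv ℝ u z (Complex.I • basisVec i)) / 2

/-- The complex Hessian `∂²Φ/∂zᵢ∂z̄ⱼ` of a real function: the coefficients `g_{i j̄}` of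
`(√-1/2) ∂∂̄Φ = (√-1/2) ∑ g_{i j̄} dzᵢ ∧ dz̄ⱼ`. -/
def complexHessian {n : ℕ} (Φ : Cn n → ℝ) (z : Cn n) : Matrix (Fin n) (Fin n) ℂ :=
  Matrix.of fun i j => dz i (dzbar j fun w => (Φ w : ℂ)) z

section Manifold

variable (n : ℕ) (M : Type*) [TopologicalSpace M] [ChartedSpace (Cn n) M]

/-- Holomorphic coordinate systems of the complex manifold `M`. -/
def holCharts : Set (OpenPartialHomeomorph M (Cn n)) :=
  IsManifold.maximalAtlas 𝓘(ℂ, Cn n) ω M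

/-- A family of sesquilinear forms on the (holomorphic) tangent spaces of `M`, linear in the first
and conjugate linear in the second variable. -/
abbrev SesqField : Type _ :=
  ∀ p : M, TangentSpace 𝓘(ℂ, Cn n) p →ₗ[ℂ] TangentSpace 𝓘(ℂ, Cn n) p →ₗ⋆[ℂ] ℂ

variable {n M}

/-- The coordinate field `∂/∂zᵢ` of the coordinate system `φ`, at the point with coordinates `z`. -/
def coordVec (φ : OpenPartialHomeomorph M (Cn n)) (z : Cn n) (i : Fin n) :
    TangentSpace 𝓘(ℂ, Cn n) (φ.symm z) :=
  mfderiv 𝓘(ℂ, Cn n) 𝓘(ℂ, Cn n) φ.symm z (basisVec i)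

/-- The matrix `g_{i j̄}` of a sesquilinear field in the coordinate system `φ`. -/
def coeff (h : SesqField n M) (φ : OpenPartialHomeomorph M (Cn n)) (z : Cn n) :
    Matrix (Fin n) (Fin n) ℂ :=
  Matrix.of fun i j => h (φ.symm z) (coordVec φ z i) (coordVec φ z j)

variable (n M)

/-- A Kähler metric on the complex manifold `M`: a smooth positive definite Hermitian form on the
tangent spaces whose fundamental form `(√-1/2) ∑ g_{i j̄} dzᵢ ∧ dz̄ⱼ` is closed. -/
structure KahlerMetric where
  form : SesqField n M
  hermitian : ∀ p v w, form p w v = conj (form p v w)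
  pos : ∀ p v, v ≠ 0 → 0 < (form p v v).re
  smooth : ∀ φ ∈ holCharts n M, ∀ i j,
    ContDiffOn ℝ ∞ (fun z => coeff form φ z i j) φ.target
  closed : ∀ φ ∈ holCharts n M, ∀ i j k, ∀ z ∈ φ.target,
    dz k (fun w => coeff form φ w i j) z = dz i (fun w => coeff form φ w k j) z

variable {n M}

theorem coeff_smul (c : ℝ) (h : SesqField n M) (φ : OpenPartialHomeomorph M (Cn n)) (z : Cn n)
    (i j : Fin n) : coeff (fun p => (c : ℂ) • h p) φ z i j = (c : ℂ) * coeff h φ z i j := rfl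

theorem dz_const_mul {n : ℕ} (c : ℂ) (i : Fin n) (u : Cn n → ℂ) (z : Cn n)
    (hu : DifferentiableAt ℝ u z) : dz i (fun w => c * u w) z = c * dz i u z := by
  unfold dz
  rw [fderiv_const_mul hu]
  simp only [smul_apply, smul_eq_mul]
  ring

/-- The metric `c g`, for a real number `c > 0`. -/
def KahlerMetric.scale (g : KahlerMetric n M) (c : ℝ) (hc : 0 < c) : KahlerMetric n M where
  form p := (c : ℂ) • g.form p
  hermitian p v w := by
    simp [g.hermitian p v w]
  pos p v hv := by
    simpa using mul_pos hc (g.pos p v hv)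
  smooth φ hφ i j := by
    simp only [coeff_smul]
    exact contDiffOn_const.mul (g.smooth φ hφ i j)
  closed φ hφ i j k z hz := by
    have hd : ∀ a b, DifferentiableAt ℝ (fun w => coeff g.form φ w a b) z := fun a b =>
      ((g.smooth φ hφ a b).contDiffAt (φ.open_target.mem_nhds hz)).differentiableAt (by simp)
    simp only [coeff_smul]
    rw [dz_const_mul _ _ _ _ (hd i j), dz_const_mul _ _ _ _ (hd k j), g.closed φ hφ i j k z hz]

/-- `g` is Ricci-flat: the Ricci form `-√-1 ∂∂̄ log det g` vanishes. -/
def KahlerMetric.IsRicciFlat (g : KahlerMetric n M) : Prop :=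
  ∀ φ ∈ holCharts n M, ∀ z ∈ φ.target,
    complexHessian (fun w => Real.log (coeff g.form φ w).det.re) z = 0

/-- The component
`R_{i j̄ k l̄} = ∂²g_{i l̄}/∂z_k∂z̄_j - ∑_{p,q} g^{p̄ q} ∂g_{i p̄}/∂z_k ∂g_{q l̄}/∂z̄_j`
of the curvature tensor, in the coordinate system `φ`. -/
def KahlerMetric.curvature (g : KahlerMetric n M) (φ : OpenPartialHomeomorph M (Cn n)) (z : Cn n)
    (i j k l : Fin n) : ℂ :=
  dz k (dzbar j fun w => coeff g.form φ w i l) z -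
    ∑ p, ∑ q, (coeff g.form φ z)⁻¹ p q *
      dz k (fun w => coeff g.form φ w i p) z * dzbar j (fun w => coeff g.form φ w q l) z

/-- `g` is flat: its curvature tensor vanishes identically. -/
def KahlerMetric.IsFlat (g : KahlerMetric n M) : Prop :=
  ∀ φ ∈ holCharts n M, ∀ z ∈ φ.target, ∀ i j k l, g.curvature φ z i j k l = 0

/-- In the coordinates `φ` the metric has a Kähler potential `Φ(z) = f(|z|²)`. -/
def KahlerMetric.IsRadialIn (g : KahlerMetric n M) (φ : OpenPartialHomeomorph M (Cn n)) : Prop :=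
  ∃ f : ℝ → ℝ, ContDiffOn ℝ ∞ (fun z : Cn n => f (‖z‖ ^ 2)) φ.target ∧
    ∀ z ∈ φ.target, coeff g.form φ z = complexHessian (fun w => f (‖w‖ ^ 2)) z

/-- `g` is radial: it admits, in suitable local holomorphic coordinates, Kähler potentials depending
only on `|z|²`. The coordinates need not be centred at the points under consideration, and such
coordinates are only required around a dense set of points; this allows for metrics like the
Eguchi--Hanson metric, radial on the complement of the exceptional divisor of a blow-up. -/
def KahlerMetric.IsRadial (g : KahlerMetric n M) : Prop :=
  Dense {p : M | ∃ φ ∈ holCharts n M, p ∈ φ.source ∧ g.IsRadialIn φ}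

end Manifold

/-- Square summable sequences `(Z₀, …, Z_N)` of complex numbers, for `N ≤ ∞`. -/
abbrev HomCoords (N : ℕ∞) : Type := lp (fun _ : {k : ℕ // (k : ℕ∞) ≤ N} => ℂ) 2

/-- The complex projective space `ℂP^N`, for `N ≤ ∞`. -/
abbrev CP (N : ℕ∞) : Type := ℙ ℂ (HomCoords N)

section Projective

variable {n : ℕ} {M : Type*} [TopologicalSpace M] [ChartedSpace (Cn n) M]

/-- `F : M → ℂP^N` is a Kähler (holomorphic and isometric) immersion of `(M, g)` into `ℂP^N` with
its Fubini--Study metric: locally `F = [s]` for a holomorphic nowhere vanishing `s = (Z₀, …, Z_N)`,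
and the metric `g` is the pull-back of the metric with Kähler form
`(√-1/2) ∂∂̄ log (|Z₀|² + ⋯ + |Z_N|²)`. -/
def IsKahlerImmersion (g : KahlerMetric n M) {N : ℕ∞} (F : M → CP N) : Prop :=
  ∀ p : M, ∃ V : Set M, IsOpen V ∧ p ∈ V ∧ ∃ s : M → HomCoords N,
    MDifferentiableOn 𝓘(ℂ, Cn n) 𝓘(ℂ, HomCoords N) s V ∧
    (∀ q ∈ V, ∃ hq : s q ≠ 0, F q = Projectivization.mk ℂ (s q) hq) ∧
    ∀ φ ∈ holCharts n M, ∀ z ∈ φ.target, φ.symm z ∈ V →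
      coeff g.form φ z = complexHessian (fun w => Real.log (‖s (φ.symm w)‖ ^ 2)) z

/-- `g` is projectively induced: `(M, g)` has a Kähler immersion into some `ℂP^N`, `N ≤ ∞`. -/
def KahlerMetric.IsProjectivelyInduced (g : KahlerMetric n M) : Prop :=
  ∃ (N : ℕ∞) (F : M → CP N), IsKahlerImmersion g F

/-- `g` is stable-projectively induced: `c g` is projectively induced for all `c` near `1`. -/
def KahlerMetric.IsStableProjectivelyInduced (g : KahlerMetric n M) : Prop :=
  ∃ ε : ℝ, 0 < ε ∧ ∀ c ∈ Set.Ioo (1 - ε) (1 + ε), ∀ hc : 0 < c,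
    (g.scale c hc).IsProjectivelyInduced

end Projective

end KahlerGeom

end

open Set Filter Topology

/-! ### Absolutely monotone analytic functions on a half-line and their entire extension -/

section AbsolutelyMonotone

/-! In dimension n ≥ 2, write r = |z|². A radial potential f(r) has Hessian matrix f' δᵢⱼ + f'' z̄ᵢ
zⱼ, with determinant h = f'ⁿ⁻¹ (f' + r f''). Ricci-flatness makes log h(|z|²) pluriharmonic, which
forces h to be a constant c > 0. Integrating once gives (r f')ⁿ = c rⁿ + b (`radial_ode`). The
metric is a multiple of the Euclidean one exactly when b = 0, so everything rests on excluding b ≠ 0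
by means of the Kähler immersion.

Let s be a local lift of the immersion, z₀ ≠ 0 a point of the radial chart, r₀ = |z₀|², and v a unit
vector orthogonal to z₀. Then f(|w|²) - log ‖s‖² is pluriharmonic, hence harmonic on the line z₀ + ζ
v, where |w|² = r₀ + |ζ|². Absorbing the harmonic term into s gives a holomorphic Hilbert-valued T
with ‖T(ζ)‖² = exp f(r₀ + |ζ|²). Averaging over circles (Parseval) shows that exp f has nonnegative
Taylor coefficients at r₀ (`exists_radial_expansion`).

The differential equation continues f analytically to [r₀, ∞), where c rⁿ + b stays positive. An
analytic function on a half-line with nonnegative derivatives at the endpoint has Taylor sums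
bounded by its values, so its Taylor series converges everywhere (`exists_entire_extension`). Thus
exp f extends to an entire G with (z G')ⁿ = (c zⁿ + b) Gⁿ. If b ≠ 0, the roots of c zⁿ + b are
simple, and at such a root the orders of the two sides differ modulo n (`eq_zero_of_entire_ode`).

So the curvature vanishes at the points of radial charts other than their origins. These are dense,
and curvature is continuous, so it vanishes everywhere. In dimension one the curvature is g ∂∂̄ log
g, and Ricci-flatness is already flatness. -/

theorem eventually_eq_of_deriv_eq_zero {u : ℝ → ℝ} {a : ℝ}
    (h : ∀ᶠ x in 𝓝 a, HasDerivAt u 0 x) : ∀ᶠ x in 𝓝 a, u x = u a := by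
  obtain ⟨ε, hε, hd⟩ := Metric.eventually_nhds_iff_ball.1 h
  refine eventually_of_mem (Metric.ball_mem_nhds a hε) fun x hx => ?_
  exact (convex_ball a ε).is_const_of_fderivWithin_eq_zero (𝕜 := ℝ)
    (fun y hy => (hd y hy).differentiableAt.differentiableWithinAt)
    (fun y hy => by
      rw [fderivWithin_of_isOpen Metric.isOpen_ball hy]
      ext; simp [(hd y hy).deriv]) hx (Metric.mem_ball_self hε)

/-- Differentiation does not shrink the ball of convergence. The common radius r lets one
neighbourhood serve all derivatives at once. -/
theorem HasFPowerSeriesOnBall.exists_iteratedDeriv {E : ℝ → ℝ} {p : FormalMultilinearSeries ℝ ℝ ℝ}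
    {y : ℝ} {r : ENNReal} (h : HasFPowerSeriesOnBall E p y r) (k : ℕ) :
    ∃ q : FormalMultilinearSeries ℝ ℝ ℝ, HasFPowerSeriesOnBall (iteratedDeriv k E) q y r := by
  induction k with
  | zero => exact ⟨p, by simpa using h⟩
  | succ k ih =>
    obtain ⟨q, hq⟩ := ih
    have h1 := (ContinuousLinearMap.apply ℝ ℝ (1 : ℝ)).comp_hasFPowerSeriesOnBall hq.fderiv
    rw [iteratedDeriv_succ]
    exact ⟨_, h1⟩

/-- Each derivative is expanded about y. Its Taylor coefficients are again derivatives of E at y,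
and x - y ≥ 0, so every term is nonnegative. -/
theorem AnalyticAt.exists_iteratedDeriv_nonneg {E : ℝ → ℝ} {y : ℝ} (hE : AnalyticAt ℝ E y)
    (h0 : ∀ k, 0 ≤ iteratedDeriv k E y) :
    ∃ δ > 0, ∀ x ∈ Ico y (y + δ), ∀ k, 0 ≤ iteratedDeriv k E x := by
  obtain ⟨p, r, hp⟩ := hE
  obtain ⟨δ, hδ, hδr⟩ := ENNReal.lt_iff_exists_nnreal_btwn.1 hp.r_pos
  refine ⟨δ, by simpa using hδ, fun x hx k => ?_⟩
  obtain ⟨q, hq⟩ := hp.exists_iteratedDeriv k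
  have hmem : x - y ∈ Metric.eball (0 : ℝ) r := by
    rw [Metric.mem_eball, edist_zero_right]
    refine lt_of_le_of_lt ?_ hδr
    rw [← ofReal_norm, Real.norm_of_nonneg (by linarith [hx.1]), ← ENNReal.ofReal_coe_nnreal]
    exact ENNReal.ofReal_le_ofReal (by linarith [hx.2])
  have hs := hq.hasSum_iteratedFDeriv hmem
  rw [add_sub_cancel] at hs
  refine hs.nonneg fun m => ?_
  have : (iteratedFDeriv ℝ m (iteratedDeriv k E) y fun _ => x - y)
      = (x - y) ^ m * iteratedDeriv (m + k) E y := by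
    have h2 := (iteratedFDeriv ℝ m (iteratedDeriv k E) y).map_smul_univ (fun _ => x - y) (fun _ => 1)
    simp only [smul_eq_mul, mul_one, Finset.prod_const, Finset.card_univ, Fintype.card_fin] at h2
    rw [h2, ← iteratedDeriv_eq_iteratedFDeriv]
    simp only [iteratedDeriv_eq_iterate, Function.iterate_add_apply]
  rw [this]
  have := pow_nonneg (sub_nonneg.2 hx.1) m
  have := h0 (m + k)
  positivity

/-- Continuity induction: the points where all derivatives are nonnegative form a closed set, and
the local expansion pushes this set to the right. -/
theorem AnalyticOnNhd.iteratedDeriv_nonneg_Ici {E : ℝ → ℝ} {a : ℝ}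
    (hE : AnalyticOnNhd ℝ E (Ici a)) (h0 : ∀ k, 0 ≤ iteratedDeriv k E a) {x : ℝ} (hx : a ≤ x)
    (k : ℕ) : 0 ≤ iteratedDeriv k E x := by
  let S : Set ℝ := {x | ∀ k, 0 ≤ iteratedDeriv k E x}
  have hcont : ∀ k, ContinuousOn (iteratedDeriv k E) (Ici a) := fun k => by
    rw [iteratedDeriv_eq_iterate]
    exact (hE.iterated_deriv k).continuousOn
  have hS : IsClosed (S ∩ Icc a x) := by
    have : S ∩ Icc a x = ⋂ k, (Icc a x ∩ iteratedDeriv k E ⁻¹' (Ici 0)) := by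
      ext y
      simp only [S, mem_inter_iff, mem_ofPred_eq, mem_iInter, mem_preimage, mem_Ici, forall_and,
        forall_const]
      tauto
    rw [this]
    exact isClosed_iInter fun k =>
      ((hcont k).mono Icc_subset_Ici_self).preimage_isClosed_of_isClosed isClosed_Icc isClosed_Ici
  have := hS.Icc_subset_of_forall_mem_nhdsWithin h0 fun y hy => by
    obtain ⟨δ, hδ, h⟩ := (hE y hy.2.1).exists_iteratedDeriv_nonneg hy.1
    filter_upwards [Ioo_mem_nhdsGT (show y < y + δ by linarith)] with t ht
    exact h t ⟨ht.1.le, ht.2⟩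
  exact this (right_mem_Icc.2 hx) k

/-- The Lagrange remainder involves a derivative at a point to the right of a, hence is nonnegative.
-/
theorem AnalyticOnNhd.sum_iteratedDeriv_le {E : ℝ → ℝ} {a : ℝ}
    (hE : AnalyticOnNhd ℝ E (Ici a)) (h0 : ∀ k, 0 ≤ iteratedDeriv k E a) {T : ℝ} (hT : a < T)
    (m : ℕ) :
    ∑ k ∈ Finset.range (m + 1), iteratedDeriv k E a / (k.factorial : ℝ) * (T - a) ^ k ≤ E T := by
  have hsub : uIcc a T ⊆ Ici a := by
    rw [uIcc_of_le hT.le]; exact Icc_subset_Ici_self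
  have hc : ContDiffOn ℝ (m + 1) E (uIcc a T) := fun x hx =>
    (hE x (hsub hx)).contDiffAt.contDiffWithinAt
  obtain ⟨x', hx', h⟩ := taylor_mean_remainder_lagrange_iteratedDeriv hT.ne hc
  rw [taylor_within_apply] at h
  have hnn : 0 ≤ iteratedDeriv (m + 1) E x' * (T - a) ^ (m + 1) / ((m + 1).factorial : ℝ) := by
    have h1 := hE.iteratedDeriv_nonneg_Ici h0 (x := x')
      (by rw [uIoo_of_lt hT] at hx'; exact hx'.1.le) (m + 1)
    have h2 := pow_nonneg (sub_nonneg.2 hT.le) (m + 1)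
    positivity
  have hsum : ∑ k ∈ Finset.range (m + 1), ((k.factorial : ℝ)⁻¹ * (T - a) ^ k) •
      iteratedDerivWithin k E (uIcc a T) a
      = ∑ k ∈ Finset.range (m + 1), iteratedDeriv k E a / (k.factorial : ℝ) * (T - a) ^ k := by
    refine Finset.sum_congr rfl fun k _ => ?_
    rw [iteratedDerivWithin_eq_iteratedDeriv (uniqueDiffOn_uIcc hT.ne)
      (hE a self_mem_Ici).contDiffAt left_mem_uIcc, smul_eq_mul]
    ring
  rw [hsum] at h
  linarith

theorem hasFPowerSeriesOnBall_tsum {𝕜 : Type*} [RCLike 𝕜] (a : ℕ → 𝕜) (x₀ : 𝕜) (ρ : NNReal)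
    (hρ : 0 < ρ) (hs : Summable fun k => ‖a k‖ * (ρ : ℝ) ^ k) :
    HasFPowerSeriesOnBall (fun z => ∑' k, a k * (z - x₀) ^ k)
      (FormalMultilinearSeries.ofScalars 𝕜 a) x₀ ρ := by
  have hr : (ρ : ENNReal) ≤ (FormalMultilinearSeries.ofScalars 𝕜 a).radius := by
    refine FormalMultilinearSeries.le_radius_of_summable_norm _ ?_
    simpa [FormalMultilinearSeries.ofScalars_norm] using hs
  have h := ((FormalMultilinearSeries.ofScalars 𝕜 a).hasFPowerSeriesOnBall
    (lt_of_lt_of_le (by exact_mod_cast hρ) hr)).mono (by exact_mod_cast hρ) hr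
  have h2 := h.comp_sub x₀
  rw [zero_add] at h2
  refine h2.congr fun z _ => ?_
  change FormalMultilinearSeries.ofScalarsSum a (z - x₀) = _
  simp [FormalMultilinearSeries.ofScalarsSum_eq_tsum]

/-- The Taylor sums at a + ρ have nonnegative terms and are bounded by E (a + ρ). As ρ is arbitrary,
the radius of convergence is infinite, and the series may be summed over ℂ. -/
theorem AnalyticOnNhd.exists_entire_extension {E : ℝ → ℝ} {a : ℝ}
    (hE : AnalyticOnNhd ℝ E (Ici a)) (h0 : ∀ k, 0 ≤ iteratedDeriv k E a) :
    ∃ G : ℂ → ℂ, Differentiable ℂ G ∧ ∀ᶠ x : ℝ in 𝓝 a, G x = E x := by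
  set c : ℕ → ℝ := fun k => iteratedDeriv k E a / (k.factorial : ℝ) with hc
  have hc0 : ∀ k, 0 ≤ c k := fun k => div_nonneg (h0 k) (by positivity)
  have hsum : ∀ ρ : NNReal, 0 < ρ → Summable fun k => c k * (ρ : ℝ) ^ k := fun ρ hρ => by
    refine summable_of_sum_range_le (c := E (a + ρ))
      (fun k => mul_nonneg (hc0 k) (by positivity)) fun m => ?_
    refine le_trans (Finset.sum_le_sum_of_subset_of_nonneg (t := Finset.range (m + 1))
      (Finset.range_mono (by omega)) fun k _ _ => mul_nonneg (hc0 k) (by positivity)) ?_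
    have := hE.sum_iteratedDeriv_le h0 (T := a + ρ) (by simpa using hρ) m
    simpa using this
  refine ⟨fun z => ∑' k, (c k : ℂ) * (z - a) ^ k, fun z => ?_, ?_⟩
  · set ρ : NNReal := ⟨‖z - a‖ + 1, by positivity⟩ with hρ
    have hρ0 : 0 < ρ := by
      rw [← NNReal.coe_pos]; change (0 : ℝ) < ‖z - a‖ + 1; positivity
    have h := hasFPowerSeriesOnBall_tsum (fun k => (c k : ℂ)) (a : ℂ) ρ hρ0
      (by simpa [abs_of_nonneg (hc0 _)] using hsum ρ hρ0)
    refine (h.analyticAt_of_mem ?_).differentiableAt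
    rw [Metric.eball_coe, mem_ball_iff_norm]
    change ‖z - a‖ < ‖z - a‖ + 1
    linarith
  · have h := (hE a self_mem_Ici).hasFPowerSeriesAt
    have h1 := (hasFPowerSeriesOnBall_tsum c a 1 one_pos
      (by simpa [abs_of_nonneg (hc0 _)] using hsum 1 one_pos)).hasFPowerSeriesAt
    filter_upwards [HasFPowerSeriesAt.eventually_hasSum_sub h,
      HasFPowerSeriesAt.eventually_hasSum_sub h1] with x hx hx1
    rw [← hx1.unique hx]
    push_cast
    rfl

/-- A primitive of the real part of a holomorphic function along the real axis is real analytic. -/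
theorem analyticAt_of_hasDerivAt_re {u : ℝ → ℝ} {P : ℂ → ℂ} {a : ℝ} (hP : AnalyticAt ℂ P a)
    (hu : ∀ᶠ x : ℝ in 𝓝 a, HasDerivAt u (P x).re x) : AnalyticAt ℝ u a := by
  obtain ⟨ε, hε, hball⟩ := Metric.eventually_nhds_iff_ball.1 hP.eventually_analyticAt
  obtain ⟨η, hη, hu⟩ := Metric.eventually_nhds_iff_ball.1 hu
  -- A holomorphic primitive U of P on a disc. Then u - Re U has zero derivative on the real axis,
  -- so u is Re U plus a constant.
  obtain ⟨U, hU⟩ := (show DifferentiableOn ℂ P (Metric.ball (a : ℂ) ε) from fun z hz =>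
    (hball z hz).differentiableAt.differentiableWithinAt).isExactOn_ball
  have hUa : AnalyticAt ℂ U a := by
    refine DifferentiableOn.analyticAt (s := Metric.ball (a : ℂ) ε) (fun z hz => ?_)
      (Metric.ball_mem_nhds _ hε)
    exact (hU z hz).differentiableAt.differentiableWithinAt
  have hre : ∀ x ∈ Metric.ball a (min ε η), HasDerivAt (fun t : ℝ => (U t).re) (P x).re x := by
    intro x hx
    refine (hU x ?_).real_of_complex
    rw [Metric.mem_ball, Complex.dist_of_im_eq (by simp)]
    exact lt_of_lt_of_le hx (min_le_left _ _)
  have hd : ∀ x ∈ Metric.ball a (min ε η), HasDerivAt (fun t => u t - (U t).re) 0 x := by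
    intro x hx
    have := (hu x (Metric.ball_subset_ball (min_le_right _ _) hx)).sub (hre x hx)
    rw [sub_self] at this
    exact this
  have hconst := eventually_eq_of_deriv_eq_zero
    (eventually_of_mem (Metric.ball_mem_nhds a (lt_min hε hη)) hd)
  have hmain : AnalyticAt ℝ (fun x : ℝ => (U x).re + (u a - (U a).re)) a := by
    refine AnalyticAt.add ?_ analyticAt_const
    exact (Complex.reCLM.analyticAt _).comp
      ((hUa.restrictScalars (𝕜 := ℝ)).comp (Complex.ofRealCLM.analyticAt a))
  refine hmain.congr ?_
  filter_upwards [hconst] with x hx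
  linarith

end AbsolutelyMonotone

/-! ### The differential equation (r f')ⁿ = c rⁿ + b and the vanishing of b -/

section Calabi

/-- An entire function `G` with `(z G')ⁿ = (c zⁿ + b) Gⁿ` on a real neighbourhood of `r₀` forces
`b = 0`: at a root of `c zⁿ + b` the orders of vanishing of both sides differ modulo `n`. -/
theorem eq_zero_of_entire_ode {n : ℕ} (hn : 2 ≤ n) {c b r₀ : ℝ} (hc : 0 < c) {G : ℂ → ℂ}
    (hG : Differentiable ℂ G) (hG0 : G r₀ ≠ 0)
    (hode : ∀ᶠ x : ℝ in 𝓝 r₀, (x * deriv G x) ^ n = (c * x ^ n + b) * G x ^ n) : b = 0 := by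
  by_contra hb
  have hA : AnalyticOnNhd ℂ G univ := fun z _ => hG.analyticAt z
  have hA' : AnalyticOnNhd ℂ (deriv G) univ := hA.deriv
  set P : ℂ → ℂ := fun z => c * z ^ n + b with hP
  have hPA : AnalyticOnNhd ℂ P univ := fun z _ => by fun_prop
  have hL : AnalyticOnNhd ℂ ((fun z => z * deriv G z) ^ n) univ := fun z hz =>
    (analyticAt_id.mul (hA' z hz)).pow n
  have hR : AnalyticOnNhd ℂ (P * G ^ n) univ := fun z hz => (hPA z hz).mul ((hA z hz).pow n)
  have heq : (fun z => z * deriv G z) ^ n = P * G ^ n := by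
    -- The equation holds on real points accumulating at r₀, so the identity theorem extends it to
    -- ℂ.
    refine hL.eq_of_frequently_eq (z₀ := (r₀ : ℂ)) hR ?_
    have ht : Tendsto (fun x : ℝ => (x : ℂ)) (𝓝[≠] r₀) (𝓝[≠] (r₀ : ℂ)) :=
      tendsto_nhdsWithin_iff.2 ⟨(Complex.continuous_ofReal.tendsto r₀).mono_left inf_le_left, by
        filter_upwards [self_mem_nhdsWithin] with x hx
        simpa using hx⟩
    refine ht.frequently (Eventually.frequently ?_)
    filter_upwards [nhdsWithin_le_nhds hode] with x hx
    simpa [hP] using hx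
  obtain ⟨ζ, hζ⟩ := IsAlgClosed.exists_pow_nat_eq (-(b : ℂ) / c) (show 0 < n by omega)
  have hc' : (c : ℂ) ≠ 0 := by exact_mod_cast hc.ne'
  have hb' : (b : ℂ) ≠ 0 := by exact_mod_cast hb
  have hζ0 : ζ ≠ 0 := by
    rintro rfl
    rw [zero_pow (by omega), eq_comm, div_eq_zero_iff] at hζ
    simp [hb', hc'] at hζ
  -- The root is simple: P' = c n zⁿ⁻¹ vanishes only at 0, and ζ ≠ 0 because b ≠ 0.
  have hPζ : analyticOrderAt P ζ = 1 := by
    refine (hPA ζ trivial).analyticOrderAt_eq_one_of_zero_deriv_ne_zero ?_ ?_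
    · simp only [hP, hζ]; field_simp; ring
    · have : HasDerivAt P (c * (n * ζ ^ (n - 1))) ζ :=
        ((hasDerivAt_pow n ζ).const_mul (c : ℂ)).add_const (b : ℂ)
      rw [this.deriv]
      have : (n : ℂ) ≠ 0 := by exact_mod_cast (by omega : n ≠ 0)
      positivity
  have hGt : analyticOrderAt G ζ ≠ ⊤ := by
    rw [Ne, analyticOrderAt_eq_top]
    intro h
    exact hG0 (congrFun (hA.eq_of_eventuallyEq (g := 0) (fun z _ => analyticAt_const) h) r₀)
  have ho := congrArg (fun f => analyticOrderAt f ζ) heq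
  rw [analyticOrderAt_mul (hPA ζ trivial) ((hA ζ trivial).pow n), hPζ,
    analyticOrderAt_pow (hA ζ trivial),
    analyticOrderAt_pow (show AnalyticAt ℂ (fun z => z * deriv G z) ζ from
      analyticAt_id.mul (hA' ζ trivial))] at ho
  obtain ⟨m, hm⟩ := ENat.ne_top_iff_exists.1 hGt
  rw [← hm] at ho
  -- An infinite order on the left is impossible, since the right side has the finite order 1 + n m.
  rcases eq_or_ne (analyticOrderAt (fun z => z * deriv G z) ζ) ⊤ with h | h
  · have hn0 : (n : ℕ∞) ≠ 0 := by exact_mod_cast (by omega : n ≠ 0)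
    rw [h, nsmul_eq_mul, ENat.mul_top hn0, nsmul_eq_mul] at ho
    have : ((1 + n * m : ℕ) : ℕ∞) = ⊤ := by rw [ho]; push_cast; rfl
    exact ENat.natCast_ne_top _ this
  · obtain ⟨k, hk⟩ := ENat.ne_top_iff_exists.1 h
    rw [← hk, nsmul_eq_mul, nsmul_eq_mul] at ho
    have h2 : n * k = 1 + n * m := by exact_mod_cast ho
    have h3 : n ∣ 1 := by
      rw [Nat.dvd_add_iff_left (dvd_mul_right n m), ← h2]; exact dvd_mul_right n k
    have := Nat.le_of_dvd one_pos h3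
    omega

/-- If `f` is a solution of `(r f')ⁿ = c rⁿ + b` and `exp f` has a one-sided power series expansion
with nonnegative coefficients, then `b = 0`. -/
theorem eq_zero_of_nonneg_expansion {n : ℕ} (hn : 2 ≤ n) {c b r₀ δ : ℝ} (hc : 0 < c)
    (hr₀ : 0 < r₀) (hδ : 0 < δ) {f f' : ℝ → ℝ} (hf : ∀ᶠ x in 𝓝 r₀, HasDerivAt f (f' x) x)
    (hf'pos : ∀ᶠ x in 𝓝 r₀, 0 < f' x) (hode : ∀ᶠ x in 𝓝 r₀, (x * f' x) ^ n = c * x ^ n + b)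
    {a : ℕ → ℝ} (ha : ∀ k, 0 ≤ a k)
    (hsum : ∀ x ∈ Ico 0 δ, HasSum (fun k => a k * x ^ k) (Real.exp (f (r₀ + x)))) : b = 0 := by
  have hn0 : n ≠ 0 := by omega
  have hpos : 0 < c * r₀ ^ n + b := by
    rw [← hode.self_of_nhds]
    exact pow_pos (mul_pos hr₀ hf'pos.self_of_nhds) n
  have hposx : ∀ x, r₀ ≤ x → 0 < c * x ^ n + b := fun x hx => by
    have : r₀ ^ n ≤ x ^ n := pow_le_pow_left₀ hr₀.le hx n
    nlinarith
  -- a globally continuous extension of `f'`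
  set p : ℝ → ℝ := fun s => (c * s ^ n + b) ^ ((n : ℝ)⁻¹) / max s (r₀ / 2) with hp
  have hpc : Continuous p := by
    refine Continuous.div ?_ (by fun_prop) fun s => ?_
    · exact Continuous.rpow_const (by fun_prop) fun s => Or.inr (by positivity)
    · exact (lt_of_lt_of_le (by positivity) (le_max_right s (r₀ / 2))).ne'
  have hpf : ∀ᶠ x in 𝓝 r₀, p x = f' x := by
    filter_upwards [hf'pos, hode, lt_mem_nhds (show r₀ / 2 < r₀ by linarith)] with x h1 h2 h3
    have hx : 0 < x := by linarith
    simp only [hp]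
    rw [← h2, Real.pow_rpow_inv_natCast (by positivity) hn0, max_eq_left h3.le]
    field_simp
  -- F coincides with f near r₀ and continues it along the half-line as a primitive of p.
  set F : ℝ → ℝ := fun x => f r₀ + ∫ s in r₀..x, p s with hF
  have hFd : ∀ x, HasDerivAt F (p x) x := fun x =>
    (intervalIntegral.integral_hasDerivAt_right (hpc.intervalIntegrable _ _)
      hpc.aestronglyMeasurable.stronglyMeasurableAtFilter hpc.continuousAt).const_add _
  have hFf : ∀ᶠ x in 𝓝 r₀, F x = f x := by
    have hd : ∀ᶠ y in 𝓝 r₀, HasDerivAt (fun t => F t - f t) 0 y := by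
      filter_upwards [hf, hpf] with y h1 h2
      have := (hFd y).sub h1
      rw [h2, sub_self] at this
      exact this
    have h0 : F r₀ = f r₀ := by simp [hF]
    filter_upwards [eventually_eq_of_deriv_eq_zero hd] with x hx
    linarith
  have hFa : ∀ x ∈ Ici r₀, AnalyticAt ℝ F x := by
    intro x hx
    have hx0 : 0 < x := hr₀.trans_le hx
    -- Near x ≥ r₀ the base c zⁿ + b lies in the slit plane, so the principal n-th root is
    -- holomorphic. On nearby reals s > r₀ / 2, so the maximum in p equals s.
    refine analyticAt_of_hasDerivAt_re
      (P := fun z => (c * z ^ n + b) ^ ((n : ℂ)⁻¹) / z) ?_ ?_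
    · refine AnalyticAt.div (AnalyticAt.cpow (by fun_prop) analyticAt_const ?_) analyticAt_id ?_
      · have : (c * (x : ℂ) ^ n + b) = ((c * x ^ n + b : ℝ) : ℂ) := by push_cast; rfl
        rw [this, Complex.ofReal_mem_slitPlane]
        exact hposx x hx
      · exact_mod_cast hx0.ne'
    · have h1 : ∀ᶠ s in 𝓝 x, 0 < c * s ^ n + b :=
        (show Continuous fun s => c * s ^ n + b by fun_prop).continuousAt.eventually
          (lt_mem_nhds (hposx x hx))
      filter_upwards [h1, lt_mem_nhds (show r₀ / 2 < x by linarith [mem_Ici.1 hx])] with s h1 h2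
      convert hFd s using 1
      have : (c * (s : ℂ) ^ n + b) ^ ((n : ℂ)⁻¹) / s = ((p s : ℝ) : ℂ) := by
        simp only [hp, max_eq_left h2.le]
        rw [Complex.ofReal_div, Complex.ofReal_cpow h1.le]
        push_cast; rfl
      rw [this, Complex.ofReal_re]
  set E : ℝ → ℝ := fun x => Real.exp (F x) with hE
  have hEa : AnalyticOnNhd ℝ E (Ici r₀) := fun x hx => (hFa x hx).rexp
  -- the Taylor coefficients of `E` at `r₀`
  have hA := (hasFPowerSeriesOnBall_tsum a r₀ (⟨δ / 2, by positivity⟩ : NNReal)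
    (show (0 : ℝ) < δ / 2 from half_pos hδ) (by
      have := (hsum (δ / 2) ⟨by positivity, by linarith⟩).summable
      simp only [Real.norm_of_nonneg (ha _)]
      exact this)).hasFPowerSeriesAt
  have hEA : E =ᶠ[𝓝 r₀] fun z => ∑' k, a k * (z - r₀) ^ k := by
    -- The expansion is known only to the right of r₀; agreement there already determines the
    -- analytic germ.
    refine ((hEa r₀ self_mem_Ici).frequently_eq_iff_eventually_eq hA.analyticAt).1 ?_
    have h1 : ∀ᶠ x in 𝓝[>] r₀, E x = ∑' k, a k * (x - r₀) ^ k := by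
      filter_upwards [Ioo_mem_nhdsGT (show r₀ < r₀ + δ by linarith), nhdsWithin_le_nhds hFf]
        with x hx hx2
      have := hsum (x - r₀) ⟨by linarith [hx.1], by linarith [hx.2]⟩
      rw [add_sub_cancel] at this
      rw [this.tsum_eq, ← hx2]
    exact h1.frequently.filter_mono (nhdsWithin_mono _ fun x hx => ne_of_gt hx)
  have hEk : ∀ k, 0 ≤ iteratedDeriv k E r₀ := by
    intro k
    have h1 := (hEa r₀ self_mem_Ici).hasFPowerSeriesAt
    have h2 := h1.eq_formalMultilinearSeries_of_eventually hA hEA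
    have h3 := congrFun (FormalMultilinearSeries.ofScalars_series_injective ℝ ℝ h2) k
    have h4 : (0 : ℝ) < (k.factorial : ℝ) := by positivity
    rw [div_eq_iff h4.ne'] at h3
    rw [h3]
    exact mul_nonneg (ha k) h4.le
  obtain ⟨G, hG, hGE⟩ := hEa.exists_entire_extension hEk
  refine eq_zero_of_entire_ode hn hc hG (r₀ := r₀) ?_ ?_
  · rw [hGE.self_of_nhds]
    exact_mod_cast (Real.exp_pos _).ne'
  · filter_upwards [hGE.eventually_nhds, hpf, hode] with x h1 h2 h3
    have hd1 : HasDerivAt (fun t : ℝ => G t) (deriv G x) x :=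
      (hG x).hasDerivAt.comp_ofReal
    have hd2 : HasDerivAt (fun t : ℝ => ((E t : ℝ) : ℂ)) ((E x * p x : ℝ) : ℂ) x :=
      ((hFd x).exp).ofReal_comp
    have hd3 : deriv G x = ((E x * p x : ℝ) : ℂ) :=
      hd1.unique (hd2.congr_of_eventuallyEq h1)
    rw [hd3, h1.self_of_nhds, h2]
    have : (c * (x : ℂ) ^ n + b) = ((c * x ^ n + b : ℝ) : ℂ) := by push_cast; rfl
    rw [this, ← h3]
    push_cast
    ring

end Calabi

/-! ### Parseval's identity for Hilbert-valued holomorphic functions -/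

section Parseval

variable {H : Type*} [NormedAddCommGroup H] [InnerProductSpace ℂ H]

theorem hasSum_integral_inner {v : ℕ → ℝ → H} {w S : ℝ → H} {M : ℕ → ℝ} {C : ℝ}
    (hw : Continuous w) (hv : ∀ k, Continuous (v k)) (hC : ∀ θ, ‖w θ‖ ≤ C)
    (hM : ∀ k θ, ‖v k θ‖ ≤ M k) (hMs : Summable M) (hS : ∀ θ, HasSum (fun k => v k θ) (S θ))
    (α β : ℝ) :
    HasSum (fun k => ∫ θ in α..β, inner ℂ (w θ) (v k θ)) (∫ θ in α..β, inner ℂ (w θ) (S θ)) := by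
  refine intervalIntegral.hasSum_integral_of_dominated_convergence (fun k _ => C * M k)
    (fun k => (hw.inner (hv k)).aestronglyMeasurable) (fun k => ?_) ?_ ?_ ?_
  · refine Eventually.of_forall fun θ _ => ?_
    refine (norm_inner_le_norm _ _).trans ?_
    exact mul_le_mul (hC θ) (hM k θ) (norm_nonneg _) ((norm_nonneg _).trans (hC θ))
  · exact Eventually.of_forall fun θ _ => hMs.mul_left C
  · exact intervalIntegrable_const
  · exact Eventually.of_forall fun θ _ => (hS θ).mapL (innerSL ℂ (w θ))

/-- Orthogonality of the characters exp(i k θ) on the circle; the factor ρ²ᵏ comes from j = k. -/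
theorem integral_inner_circleMap_pow (s t : H) (ρ : ℝ) (j k : ℕ) :
    ∫ θ in (0 : ℝ)..2 * Real.pi, inner ℂ (circleMap 0 ρ θ ^ j • s) (circleMap 0 ρ θ ^ k • t)
      = if j = k then 2 * Real.pi * ρ ^ (2 * k) * inner ℂ s t else 0 := by
  have h1 : ∀ θ : ℝ, inner ℂ (circleMap 0 ρ θ ^ j • s) (circleMap 0 ρ θ ^ k • t)
      = (ρ ^ (j + k) * inner ℂ s t) * Complex.exp (((k : ℂ) - j) * Complex.I * θ) := fun θ => by
    have hexp : Complex.exp (((k : ℂ) - j) * Complex.I * θ)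
        = Complex.exp (-(θ * Complex.I)) ^ j * Complex.exp (θ * Complex.I) ^ k := by
      rw [← Complex.exp_nat_mul, ← Complex.exp_nat_mul, ← Complex.exp_add]
      congr 1; ring
    have hconj : conj (Complex.exp (θ * Complex.I)) = Complex.exp (-(θ * Complex.I)) := by
      rw [← Complex.exp_conj]; simp
    rw [hexp, inner_smul_left, inner_smul_right, circleMap_zero, map_pow, map_mul, hconj,
      Complex.conj_ofReal, mul_pow, mul_pow, pow_add]
    ring
  simp only [h1]
  rw [intervalIntegral.integral_const_mul]
  split_ifs with hjk
  · subst hjk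
    simp
    ring
  · have hne : ((k : ℂ) - j) * Complex.I ≠ 0 :=
      mul_ne_zero (sub_ne_zero.2 (by exact_mod_cast Ne.symm hjk)) Complex.I_ne_zero
    rw [integral_exp_mul_complex hne]
    have : ((k : ℂ) - j) * Complex.I * ((2 * Real.pi : ℝ) : ℂ)
        = ((k - j : ℤ) : ℂ) * (2 * Real.pi * Complex.I) := by push_cast; ring
    rw [this, Complex.exp_int_mul_two_pi_mul_I]
    simp

/-- If the norm of a Hilbert space valued holomorphic function is a function of `|ζ|²`, then this
function is a power series with nonnegative coefficients. -/
theorem exists_nonneg_expansion [CompleteSpace H] {T : ℂ → H} {δ : ℝ}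
    (hT : DifferentiableOn ℂ T (Metric.ball 0 δ)) {g : ℝ → ℝ}
    (hg : ∀ ζ ∈ Metric.ball (0 : ℂ) δ, ‖T ζ‖ ^ 2 = g (‖ζ‖ ^ 2)) :
    ∃ a : ℕ → ℝ, (∀ k, 0 ≤ a k) ∧
      ∀ ρ ∈ Ico 0 δ, HasSum (fun k => a k * (ρ ^ 2) ^ k) (g (ρ ^ 2)) := by
  set t : ℕ → H := fun k => (k.factorial : ℂ)⁻¹ • iteratedDeriv k T 0 with ht
  have hsum : ∀ ζ ∈ Metric.ball (0 : ℂ) δ, HasSum (fun k => ζ ^ k • t k) (T ζ) := fun ζ hζ => by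
    have := Complex.hasSum_taylorSeries_on_ball hT hζ
    simp only [sub_zero] at this
    refine this.congr_fun fun k => ?_
    rw [ht, smul_comm]
  refine ⟨fun k => ‖t k‖ ^ 2, fun k => by positivity, fun ρ hρ => ?_⟩
  -- The terms at the larger radius ρ' are bounded, so those at ρ are dominated by a geometric
  -- series of ratio ρ / ρ'. This justifies termwise integration.
  obtain ⟨ρ', h1, h2⟩ := exists_between hρ.2
  have hρ' : 0 < ρ' := hρ.1.trans_lt h1
  have hMs : Summable fun k => ρ ^ k * ‖t k‖ := by
    have h := (hsum (ρ' : ℂ) (by simpa [abs_of_pos hρ'] using h2)).summable.tendsto_atTop_zero.norm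
    obtain ⟨C, hC⟩ := h.bddAbove_range
    refine Summable.of_nonneg_of_le (fun k => by have := hρ.1; positivity) (fun k => ?_)
      ((summable_geometric_of_lt_one (div_nonneg hρ.1 hρ'.le) ((div_lt_one hρ').2 h1)).mul_left C)
    have hk : ρ' ^ k * ‖t k‖ ≤ C := by
      have := hC (mem_range_self k)
      simpa [norm_smul, abs_of_pos hρ'] using this
    have : ρ ^ k * ‖t k‖ = (ρ' ^ k * ‖t k‖) * (ρ / ρ') ^ k := by
      rw [div_pow]; field_simp
    rw [this]
    exact mul_le_mul_of_nonneg_right hk (pow_nonneg (div_nonneg hρ.1 hρ'.le) k)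
  set v : ℕ → ℝ → H := fun k θ => circleMap 0 ρ θ ^ k • t k with hv
  have hvc : ∀ k, Continuous (v k) := fun k => by
    exact ((continuous_circleMap 0 ρ).pow k).smul continuous_const
  have hvM : ∀ k θ, ‖v k θ‖ ≤ ρ ^ k * ‖t k‖ := fun k θ => by
    simp [hv, norm_smul, abs_of_nonneg hρ.1]
  have hmem : ∀ θ, circleMap 0 ρ θ ∈ Metric.ball (0 : ℂ) δ := fun θ => by
    simpa [abs_of_nonneg hρ.1] using hρ.2
  have hS : ∀ θ, HasSum (fun k => v k θ) (T (circleMap 0 ρ θ)) := fun θ => hsum _ (hmem θ)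
  have hTc : Continuous fun θ => T (circleMap 0 ρ θ) :=
    hT.continuousOn.comp_continuous (continuous_circleMap 0 ρ) hmem
  have hTn : ∀ θ, ‖T (circleMap 0 ρ θ)‖ ^ 2 = g (ρ ^ 2) := fun θ => by
    rw [hg _ (hmem θ)]; simp
  have hTC : ∀ θ, ‖T (circleMap 0 ρ θ)‖ ≤ Real.sqrt (g (ρ ^ 2)) := fun θ => by
    rw [← hTn θ, Real.sqrt_sq (norm_nonneg _)]
  -- T is expanded in the second slot of the inner product, where only the k-th mode survives.
  -- Conjugation then moves T to the first slot, and the value is real.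
  have hone : ∀ k, ∫ θ in (0 : ℝ)..2 * Real.pi, inner ℂ (T (circleMap 0 ρ θ)) (v k θ)
      = 2 * Real.pi * (‖t k‖ ^ 2 * (ρ ^ 2) ^ k : ℝ) := fun k => by
    have h3 := hasSum_integral_inner (hvc k) hvc (hvM k) hvM hMs hS 0 (2 * Real.pi)
    have h4 : HasSum (fun j => ∫ θ in (0 : ℝ)..2 * Real.pi, inner ℂ (v k θ) (v j θ))
        (∫ θ in (0 : ℝ)..2 * Real.pi, inner ℂ (v k θ) (v k θ)) :=
      hasSum_single k fun j hj => by
        simp only [hv]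
        rw [integral_inner_circleMap_pow, if_neg (Ne.symm hj)]
    have h5 := h3.unique h4
    simp only [hv] at h5
    rw [integral_inner_circleMap_pow, if_pos rfl, inner_self_eq_norm_sq_to_K] at h5
    have h6 : ∀ θ, inner ℂ (T (circleMap 0 ρ θ)) (v k θ)
        = Complex.conjCLE (inner ℂ (v k θ) (T (circleMap 0 ρ θ))) := fun θ => by
      simp
    simp only [h6]
    have h7 := (Complex.conjCLE : ℂ →L[ℝ] ℂ).intervalIntegral_comp_comm
      (μ := MeasureTheory.volume) (a := 0) (b := 2 * Real.pi)
      (f := fun θ => inner ℂ (v k θ) (T (circleMap 0 ρ θ)))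
      (((hvc k).inner hTc).intervalIntegrable _ _)
    refine h7.trans ?_
    rw [show (∫ θ in (0 : ℝ)..2 * Real.pi, inner ℂ (v k θ) (T (circleMap 0 ρ θ))) = _ from h5]
    have h8 : (2 * Real.pi * ρ ^ (2 * k) * (‖t k‖ : ℂ) ^ 2 : ℂ)
        = ((2 * Real.pi * (‖t k‖ ^ 2 * (ρ ^ 2) ^ k) : ℝ) : ℂ) := by
      push_cast; ring
    erw [h8]
    simp only [ContinuousLinearEquiv.coe_coe, Complex.conjCLE_apply, Complex.conj_ofReal]
    push_cast
    rfl
  have hfin := hasSum_integral_inner hTc hvc hTC hvM hMs hS 0 (2 * Real.pi)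
  have hself : ∀ θ, inner ℂ (T (circleMap 0 ρ θ)) (T (circleMap 0 ρ θ)) = ((g (ρ ^ 2) : ℝ) : ℂ) :=
    fun θ => by rw [inner_self_eq_norm_sq_to_K, ← hTn θ]; simp
  simp only [hone, hself] at hfin
  rw [intervalIntegral.integral_const, sub_zero, Complex.real_smul] at hfin
  have hpi : ((2 * Real.pi : ℝ) : ℂ) ≠ 0 := by exact_mod_cast Real.two_pi_pos.ne'
  have h8 := hfin.mul_left ((2 * Real.pi : ℝ) : ℂ)⁻¹
  rw [inv_mul_cancel_left₀ hpi] at h8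
  rw [← Complex.hasSum_ofReal]
  refine h8.congr_fun fun k => ?_
  push_cast at hpi ⊢
  rw [inv_mul_cancel_left₀ hpi]

/-- If `g (|ζ|²) - log ‖S ζ‖²` is harmonic for a holomorphic `S`, then `exp g` is a power series
with nonnegative coefficients. -/
theorem exists_nonneg_expansion_of_harmonic [CompleteSpace H] {S : ℂ → H} {δ : ℝ}
    (hS : DifferentiableOn ℂ S (Metric.ball 0 δ)) (hS0 : ∀ ζ ∈ Metric.ball (0 : ℂ) δ, S ζ ≠ 0)
    {g : ℝ → ℝ}
    (hg : InnerProductSpace.HarmonicOnNhd (fun ζ : ℂ => g (‖ζ‖ ^ 2) - Real.log (‖S ζ‖ ^ 2))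
      (Metric.ball 0 δ)) :
    ∃ a : ℕ → ℝ, (∀ k, 0 ≤ a k) ∧
      ∀ ρ ∈ Ico 0 δ, HasSum (fun k => a k * (ρ ^ 2) ^ k) (Real.exp (g (ρ ^ 2))) := by
  obtain ⟨F, hF, hFg⟩ := hg.exists_analyticOnNhd_ball_re_eq
  -- With F holomorphic and Re F the given harmonic function, ‖exp(F / 2) S‖² = exp(Re F) ‖S‖² = exp
  -- g.
  refine exists_nonneg_expansion (g := fun x => Real.exp (g x))
    (T := fun ζ => Complex.exp (F ζ / 2) • S ζ) ?_ fun ζ hζ => ?_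
  · exact (hF.differentiableOn.div_const 2).cexp.smul hS
  · have h1 : (F ζ).re = g (‖ζ‖ ^ 2) - Real.log (‖S ζ‖ ^ 2) := hFg hζ
    have h2 : 0 < ‖S ζ‖ ^ 2 := by have := norm_pos_iff.2 (hS0 ζ hζ); positivity
    have h3 : g (‖ζ‖ ^ 2) = (F ζ).re + Real.log (‖S ζ‖ ^ 2) := by linarith
    rw [norm_smul, Complex.norm_exp, mul_pow, ← Real.exp_nat_mul, h3, Real.exp_add, Real.exp_log h2]
    congr 2
    simp
    ring

end Parseval

namespace KahlerGeom

/-! ### Wirtinger calculus and radial functions -/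

section Wirtinger

variable {n : ℕ}

theorem dz_congr {u v : Cn n → ℂ} {z : Cn n} (h : u =ᶠ[𝓝 z] v) (i : Fin n) :
    dz i u z = dz i v z := by
  unfold dz; rw [h.fderiv_eq]

theorem dzbar_congr {u v : Cn n → ℂ} {z : Cn n} (h : u =ᶠ[𝓝 z] v) (i : Fin n) :
    dzbar i u z = dzbar i v z := by
  unfold dzbar; rw [h.fderiv_eq]

theorem eventually_dzbar_congr {u v : Cn n → ℂ} {z : Cn n} (h : u =ᶠ[𝓝 z] v) (i : Fin n) :
    dzbar i u =ᶠ[𝓝 z] dzbar i v :=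
  h.eventuallyEq_nhds.mono fun _ hw => dzbar_congr hw i

theorem dz_mul {u v : Cn n → ℂ} {z : Cn n} (hu : DifferentiableAt ℝ u z)
    (hv : DifferentiableAt ℝ v z) (i : Fin n) :
    dz i (fun w => u w * v w) z = dz i u z * v z + u z * dz i v z := by
  unfold dz
  rw [fderiv_fun_mul hu hv]
  simp only [add_apply, smul_apply, smul_eq_mul]
  ring

theorem dzbar_mul {u v : Cn n → ℂ} {z : Cn n} (hu : DifferentiableAt ℝ u z)
    (hv : DifferentiableAt ℝ v z) (i : Fin n) :
    dzbar i (fun w => u w * v w) z = dzbar i u z * v z + u z * dzbar i v z := by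
  unfold dzbar
  rw [fderiv_fun_mul hu hv]
  simp only [add_apply, smul_apply, smul_eq_mul]
  ring

theorem dz_sum {ι : Type*} (s : Finset ι) {u : ι → Cn n → ℂ} {z : Cn n}
    (hu : ∀ a ∈ s, DifferentiableAt ℝ (u a) z) (i : Fin n) :
    dz i (fun w => ∑ a ∈ s, u a w) z = ∑ a ∈ s, dz i (u a) z := by
  unfold dz
  rw [fderiv_fun_sum hu]
  simp only [sum_apply, Finset.mul_sum, ← Finset.sum_sub_distrib, Finset.sum_div]

theorem dzbar_sum {ι : Type*} (s : Finset ι) {u : ι → Cn n → ℂ} {z : Cn n}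
    (hu : ∀ a ∈ s, DifferentiableAt ℝ (u a) z) (i : Fin n) :
    dzbar i (fun w => ∑ a ∈ s, u a w) z = ∑ a ∈ s, dzbar i (u a) z := by
  unfold dzbar
  rw [fderiv_fun_sum hu]
  simp only [sum_apply, Finset.mul_sum, ← Finset.sum_add_distrib, Finset.sum_div]

theorem dz_of_differentiableAt {u : Cn n → ℂ} {z : Cn n} (hu : DifferentiableAt ℂ u z)
    (i : Fin n) : dz i u z = fderiv ℂ u z (basisVec i) := by
  unfold dz
  rw [hu.fderiv_restrictScalars ℝ]
  simp only [ContinuousLinearMap.coe_restrictScalars', map_smul, smul_eq_mul]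
  linear_combination (-(1 / 2 : ℂ) * fderiv ℂ u z (basisVec i)) * Complex.I_mul_I

theorem dzbar_of_differentiableAt {u : Cn n → ℂ} {z : Cn n} (hu : DifferentiableAt ℂ u z)
    (i : Fin n) : dzbar i u z = 0 := by
  unfold dzbar
  rw [hu.fderiv_restrictScalars ℝ]
  simp only [ContinuousLinearMap.coe_restrictScalars', map_smul, smul_eq_mul]
  linear_combination ((1 / 2 : ℂ) * fderiv ℂ u z (basisVec i)) * Complex.I_mul_I

theorem dz_conj {u : Cn n → ℂ} {z : Cn n} (hu : DifferentiableAt ℝ u z) (i : Fin n) :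
    dz i (fun w => conj (u w)) z = conj (dzbar i u z) := by
  have h : HasFDerivAt (fun w => conj (u w))
      ((Complex.conjCLE : ℂ →L[ℝ] ℂ).comp (fderiv ℝ u z)) z :=
    (Complex.conjCLE : ℂ →L[ℝ] ℂ).hasFDerivAt.comp z hu.hasFDerivAt
  have h2 : conj (2 : ℂ) = 2 := Complex.conj_ofNat 2
  unfold dz dzbar
  rw [h.fderiv]
  simp [h2]
  ring

theorem dzbar_conj {u : Cn n → ℂ} {z : Cn n} (hu : DifferentiableAt ℝ u z) (i : Fin n) :
    dzbar i (fun w => conj (u w)) z = conj (dz i u z) := by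
  have h : HasFDerivAt (fun w => conj (u w))
      ((Complex.conjCLE : ℂ →L[ℝ] ℂ).comp (fderiv ℝ u z)) z :=
    (Complex.conjCLE : ℂ →L[ℝ] ℂ).hasFDerivAt.comp z hu.hasFDerivAt
  have h2 : conj (2 : ℂ) = 2 := Complex.conj_ofNat 2
  unfold dz dzbar
  rw [h.fderiv]
  simp [h2]

theorem contDiffAt_dz {u : Cn n → ℂ} {z : Cn n} {m k : WithTop ℕ∞} (hu : ContDiffAt ℝ m u z)
    (hk : k + 1 ≤ m) (i : Fin n) : ContDiffAt ℝ k (dz i u) z := by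
  have h : ContDiffAt ℝ k (fderiv ℝ u) z := hu.fderiv_right hk
  exact ((h.clm_apply contDiffAt_const).sub
    (contDiffAt_const.mul (h.clm_apply contDiffAt_const))).div_const 2

theorem contDiffAt_dzbar {u : Cn n → ℂ} {z : Cn n} {m k : WithTop ℕ∞} (hu : ContDiffAt ℝ m u z)
    (hk : k + 1 ≤ m) (i : Fin n) : ContDiffAt ℝ k (dzbar i u) z := by
  have h : ContDiffAt ℝ k (fderiv ℝ u) z := hu.fderiv_right hk
  exact ((h.clm_apply contDiffAt_const).add
    (contDiffAt_const.mul (h.clm_apply contDiffAt_const))).div_const 2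

/-- The Wirtinger derivatives of a composition `h ∘ u` of real functions. -/
theorem dz_ofReal_comp {h : ℝ → ℝ} {h' : ℝ} {u : Cn n → ℝ} {z : Cn n}
    (hh : HasDerivAt h h' (u z)) (hu : DifferentiableAt ℝ u z) (i : Fin n) :
    dz i (fun w => ((h (u w) : ℝ) : ℂ)) z = h' * dz i (fun w => (u w : ℂ)) z := by
  have h1 : HasFDerivAt (fun w => (u w : ℂ)) (Complex.ofRealCLM.comp (fderiv ℝ u z)) z :=
    Complex.ofRealCLM.hasFDerivAt.comp z hu.hasFDerivAt
  have h2 : HasFDerivAt (fun w => ((h (u w) : ℝ) : ℂ))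
      (Complex.ofRealCLM.comp (h' • fderiv ℝ u z)) z :=
    Complex.ofRealCLM.hasFDerivAt.comp z (hh.comp_hasFDerivAt z hu.hasFDerivAt)
  unfold dz
  rw [h1.fderiv, h2.fderiv]
  simp
  ring

theorem dzbar_ofReal_comp {h : ℝ → ℝ} {h' : ℝ} {u : Cn n → ℝ} {z : Cn n}
    (hh : HasDerivAt h h' (u z)) (hu : DifferentiableAt ℝ u z) (i : Fin n) :
    dzbar i (fun w => ((h (u w) : ℝ) : ℂ)) z = h' * dzbar i (fun w => (u w : ℂ)) z := by
  have h1 : HasFDerivAt (fun w => (u w : ℂ)) (Complex.ofRealCLM.comp (fderiv ℝ u z)) z :=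
    Complex.ofRealCLM.hasFDerivAt.comp z hu.hasFDerivAt
  have h2 : HasFDerivAt (fun w => ((h (u w) : ℝ) : ℂ))
      (Complex.ofRealCLM.comp (h' • fderiv ℝ u z)) z :=
    Complex.ofRealCLM.hasFDerivAt.comp z (hh.comp_hasFDerivAt z hu.hasFDerivAt)
  unfold dzbar
  rw [h1.fderiv, h2.fderiv]
  simp
  ring

theorem differentiable_coord (j : Fin n) : Differentiable ℂ fun w : Cn n => w j :=
  (EuclideanSpace.proj (𝕜 := ℂ) j).differentiable

theorem dz_coord (i j : Fin n) (z : Cn n) :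
    dz i (fun w : Cn n => w j) z = if i = j then 1 else 0 := by
  rw [dz_of_differentiableAt (differentiable_coord j z)]
  have : HasFDerivAt (fun w : Cn n => w j) (EuclideanSpace.proj (𝕜 := ℂ) j : Cn n →L[ℂ] ℂ) z :=
    (EuclideanSpace.proj (𝕜 := ℂ) j).hasFDerivAt
  rw [this.fderiv]
  simp [basisVec, eq_comm]

theorem ofReal_norm_sq_eq_sum (z : Cn n) : ((‖z‖ ^ 2 : ℝ) : ℂ) = ∑ a, z a * conj (z a) := by
  rw [EuclideanSpace.norm_sq_eq]
  push_cast
  exact Finset.sum_congr rfl fun a _ => (Complex.mul_conj' (z a)).symm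

theorem dz_norm_sq (i : Fin n) (z : Cn n) :
    dz i (fun w : Cn n => ((‖w‖ ^ 2 : ℝ) : ℂ)) z = conj (z i) := by
  have hd : ∀ a, DifferentiableAt ℝ (fun w : Cn n => w a) z := fun a =>
    (differentiable_coord a z).restrictScalars ℝ
  have hd' : ∀ a, DifferentiableAt ℝ (fun w : Cn n => (conj (w a) : ℂ)) z := fun a =>
    (Complex.conjCLE : ℂ →L[ℝ] ℂ).differentiableAt.comp z (hd a)
  simp only [ofReal_norm_sq_eq_sum]
  rw [dz_sum _ fun a _ => (hd a).fun_mul (hd' a)]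
  simp [dz_mul (hd _) (hd' _), dz_coord, dz_conj (hd _),
    dzbar_of_differentiableAt (differentiable_coord _ z)]

theorem dzbar_norm_sq (i : Fin n) (z : Cn n) :
    dzbar i (fun w : Cn n => ((‖w‖ ^ 2 : ℝ) : ℂ)) z = z i := by
  have hd : ∀ a, DifferentiableAt ℝ (fun w : Cn n => w a) z := fun a =>
    (differentiable_coord a z).restrictScalars ℝ
  have hd' : ∀ a, DifferentiableAt ℝ (fun w : Cn n => (conj (w a) : ℂ)) z := fun a =>
    (Complex.conjCLE : ℂ →L[ℝ] ℂ).differentiableAt.comp z (hd a)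
  simp only [ofReal_norm_sq_eq_sum]
  rw [dzbar_sum _ fun a _ => (hd a).fun_mul (hd' a)]
  simp [dzbar_mul (hd _) (hd' _), dz_coord, dzbar_conj (hd _),
    dzbar_of_differentiableAt (differentiable_coord _ z)]

/-- The complex Hessian of a radial function. -/
theorem complexHessian_radial {h : ℝ → ℝ} {z : Cn n} (hh : ContDiffAt ℝ 2 h (‖z‖ ^ 2))
    (i j : Fin n) :
    complexHessian (fun w : Cn n => h (‖w‖ ^ 2)) z i j
      = deriv h (‖z‖ ^ 2) * (if i = j then 1 else 0)
        + deriv (deriv h) (‖z‖ ^ 2) * (conj (z i) * z j) := by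
  have hn : Differentiable ℝ fun w : Cn n => ‖w‖ ^ 2 := fun w =>
    (contDiff_norm_sq ℝ (n := 1)).differentiable (by simp) w
  have hev : ∀ᶠ r in 𝓝 (‖z‖ ^ 2), HasDerivAt h (deriv h r) r := by
    filter_upwards [hh.eventually (by simp)] with r hr
    exact (hr.differentiableAt (by simp)).hasDerivAt
  have hd2 : HasDerivAt (deriv h) (deriv (deriv h) (‖z‖ ^ 2)) (‖z‖ ^ 2) := by
    have : ContDiffAt ℝ 1 (deriv h) (‖z‖ ^ 2) := ContDiffAt.derivWithin hh (by norm_num)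
    exact (this.differentiableAt (by simp)).hasDerivAt
  have hev2 : (dzbar j fun w : Cn n => ((h (‖w‖ ^ 2) : ℝ) : ℂ))
      =ᶠ[𝓝 z] fun w => ((deriv h (‖w‖ ^ 2) : ℝ) : ℂ) * w j := by
    filter_upwards [(hn z).continuousAt.eventually hev] with w hw
    rw [dzbar_ofReal_comp hw (hn w), dzbar_norm_sq]
  simp only [complexHessian, Matrix.of_apply]
  rw [dz_congr hev2, dz_mul ?_ ((differentiable_coord j z).restrictScalars ℝ), dz_coord,
    dz_ofReal_comp hd2 (hn z), dz_norm_sq]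
  · ring
  · have h1 : DifferentiableAt ℝ (deriv h ∘ fun w : Cn n => ‖w‖ ^ 2) z :=
      hd2.differentiableAt.comp z (hn z)
    exact Complex.ofRealCLM.differentiableAt.comp z h1

end Wirtinger

/-! ### The Levi form and restriction to complex lines -/

section Levi

variable {n : ℕ}

/-- The sesquilinear form associated with a real bilinear form. -/
noncomputable def leviForm (B : Cn n →L[ℝ] Cn n →L[ℝ] ℝ) (a b : Cn n) : ℂ :=
  ((B a b : ℂ) + Complex.I * B a (Complex.I • b) - Complex.I * B (Complex.I • a) b
    + B (Complex.I • a) (Complex.I • b)) / 4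

theorem smul_eq_re_add_im (c : ℂ) (a : Cn n) : c • a = c.re • a + c.im • Complex.I • a := by
  conv_lhs => rw [← Complex.re_add_im c]
  rw [add_smul, mul_smul]
  simp only [Complex.coe_smul]

theorem I_smul_smul (c : ℂ) (a : Cn n) :
    Complex.I • c • a = c.re • Complex.I • a - c.im • a := by
  rw [smul_smul, smul_eq_re_add_im]
  simp
  abel

/-- `leviForm B` as a linear map in the first variable. -/
noncomputable def leviFormLeft (B : Cn n →L[ℝ] Cn n →L[ℝ] ℝ) (b : Cn n) : Cn n →ₗ[ℂ] ℂ where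
  toFun a := leviForm B a b
  map_add' x y := by
    simp only [leviForm, smul_add, map_add, add_apply, Complex.ofReal_add]; ring
  map_smul' c x := by
    simp only [leviForm, I_smul_smul c]
    simp only [smul_eq_re_add_im c, map_add, map_sub, add_apply, sub_apply,
      map_smul, smul_apply, Complex.ofReal_add, Complex.ofReal_sub, smul_eq_mul,
      Complex.ofReal_mul, RingHom.id_apply]
    conv_rhs => rw [← Complex.re_add_im c]
    ring_nf
    simp only [Complex.I_sq]
    ring

/-- `leviForm B` as a conjugate linear map in the second variable. -/
noncomputable def leviFormRight (B : Cn n →L[ℝ] Cn n →L[ℝ] ℝ) (a : Cn n) : Cn n →ₗ⋆[ℂ] ℂ where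
  toFun b := leviForm B a b
  map_add' x y := by
    simp only [leviForm, smul_add, map_add, Complex.ofReal_add]; ring
  map_smul' c x := by
    have hc : conj c = c.re - c.im * Complex.I := by
      apply Complex.ext <;> simp
    simp only [leviForm, I_smul_smul c]
    simp only [smul_eq_re_add_im c, map_add, map_sub, map_smul, Complex.ofReal_add, Complex.ofReal_sub, smul_eq_mul,
      Complex.ofReal_mul, hc]
    ring_nf
    simp only [Complex.I_sq]
    ring

theorem sum_basisVec (v : Cn n) : ∑ i, v i • basisVec i = v := by
  ext j
  simp [basisVec, Pi.single_apply]

theorem leviForm_eq_sum (B : Cn n →L[ℝ] Cn n →L[ℝ] ℝ) (v : Cn n) :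
    leviForm B v v = ∑ i, ∑ j, v i * conj (v j) * leviForm B (basisVec i) (basisVec j) := by
  have h1 : ∀ b, leviForm B v b = ∑ i, v i * leviForm B (basisVec i) b := fun b => by
    change leviFormLeft B b v = ∑ i, v i * leviFormLeft B b (basisVec i)
    conv_lhs => rw [← sum_basisVec v]
    simp
  have h2 : ∀ a, leviForm B a v = ∑ j, conj (v j) * leviForm B a (basisVec j) := fun a => by
    change leviFormRight B a v = ∑ i, conj (v i) * leviFormRight B a (basisVec i)
    conv_lhs => rw [← sum_basisVec v]
    simp
  rw [h1]
  refine Finset.sum_congr rfl fun i _ => ?_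
  rw [h2, Finset.mul_sum]
  exact Finset.sum_congr rfl fun j _ => by ring

/-- Symmetry of B cancels the mixed terms. When B is a second derivative, what remains is a quarter
of the Laplacian along the complex line spanned by v. -/
theorem leviForm_self (B : Cn n →L[ℝ] Cn n →L[ℝ] ℝ) (hB : ∀ a b, B a b = B b a) (v : Cn n) :
    leviForm B v v = ((B v v + B (Complex.I • v) (Complex.I • v) : ℝ) : ℂ) / 4 := by
  unfold leviForm
  rw [hB v (Complex.I • v)]
  push_cast
  ring

/-- Expresses the Wirtinger derivatives through the real second derivative, which can be evaluated
on arbitrary vectors and not only on the coordinate ones. -/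
theorem complexHessian_eq_leviForm {Φ : Cn n → ℝ} {z : Cn n} (hΦ : ContDiffAt ℝ 2 Φ z)
    (i j : Fin n) :
    complexHessian Φ z i j = leviForm (fderiv ℝ (fderiv ℝ Φ) z) (basisVec i) (basisVec j) := by
  have hB : HasFDerivAt (fderiv ℝ Φ) (fderiv ℝ (fderiv ℝ Φ) z) z :=
    ((hΦ.fderiv_right (m := 1) (by norm_num)).differentiableAt (by simp)).hasFDerivAt
  have hev : (dzbar j fun w => (Φ w : ℂ)) =ᶠ[𝓝 z] fun w =>
      ((fderiv ℝ Φ w (basisVec j) : ℝ) + Complex.I * (fderiv ℝ Φ w (Complex.I • basisVec j) : ℝ))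
        / 2 := by
    filter_upwards [hΦ.eventually (by simp)] with w hw
    have h1 : HasFDerivAt (fun w => (Φ w : ℂ)) (Complex.ofRealCLM.comp (fderiv ℝ Φ w)) w :=
      Complex.ofRealCLM.hasFDerivAt.comp w (hw.differentiableAt (by simp)).hasFDerivAt
    unfold dzbar
    rw [h1.fderiv]
    simp
  have hval : ∀ c : Cn n, HasFDerivAt (fun w => ((fderiv ℝ Φ w c : ℝ) : ℂ))
      (Complex.ofRealCLM.comp ((fderiv ℝ (fderiv ℝ Φ) z).flip c)) z := fun c =>
    Complex.ofRealCLM.hasFDerivAt.comp z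
      (by simpa using hB.clm_apply (hasFDerivAt_const c z))
  have hd := ((hval (basisVec j)).add ((hval (Complex.I • basisVec j)).const_mul Complex.I)).mul_const
    (2⁻¹ : ℂ)
  simp only [complexHessian, Matrix.of_apply]
  rw [dz_congr hev]
  unfold dz leviForm
  simp only [div_eq_mul_inv]
  erw [hd.fderiv]
  simp
  ring_nf
  simp only [Complex.I_sq]
  ring

theorem complexHessian_sub {Φ Ψ : Cn n → ℝ} {z : Cn n} (hΦ : ContDiffAt ℝ 2 Φ z)
    (hΨ : ContDiffAt ℝ 2 Ψ z) :
    complexHessian (fun w => Φ w - Ψ w) z = complexHessian Φ z - complexHessian Ψ z := by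
  ext i j
  rw [Matrix.sub_apply, complexHessian_eq_leviForm hΦ, complexHessian_eq_leviForm hΨ,
    complexHessian_eq_leviForm (hΦ.sub hΨ)]
  have hev : fderiv ℝ (fun w => Φ w - Ψ w) =ᶠ[𝓝 z] fun w => fderiv ℝ Φ w - fderiv ℝ Ψ w := by
    filter_upwards [hΦ.eventually (by simp), hΨ.eventually (by simp)] with w h1 h2
    exact fderiv_fun_sub (h1.differentiableAt (by simp)) (h2.differentiableAt (by simp))
  rw [hev.fderiv_eq, fderiv_fun_sub
    ((hΦ.fderiv_right (m := 1) (by norm_num)).differentiableAt (by simp))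
    ((hΨ.fderiv_right (m := 1) (by norm_num)).differentiableAt (by simp))]
  simp only [leviForm, sub_apply, Complex.ofReal_sub]
  ring

/-- A pluriharmonic function is harmonic along complex lines. -/
theorem harmonicAt_slice {U : Cn n → ℝ} {z v : Cn n} {ζ : ℂ}
    (h : ∀ᶠ w in 𝓝 (z + ζ • v), ContDiffAt ℝ 2 U w ∧ complexHessian U w = 0) :
    InnerProductSpace.HarmonicAt (fun ξ : ℂ => U (z + ξ • v)) ζ := by
  set L : ℂ →L[ℝ] Cn n := (ContinuousLinearMap.toSpanSingleton ℂ v).restrictScalars ℝ with hL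
  have hLa : ∀ ξ, L ξ = ξ • v := fun ξ => by simp [hL]
  have haff : ∀ ξ, HasFDerivAt (fun ξ : ℂ => z + ξ • v) L ξ := fun ξ => by
    have := L.hasFDerivAt (x := ξ)
    simpa [hLa] using this.const_add z
  have hcont : Continuous fun ξ : ℂ => z + ξ • v := by fun_prop
  have hev := hcont.continuousAt.eventually h
  refine ⟨?_, ?_⟩
  · refine ContDiffAt.comp ζ (h.self_of_nhds).1 ?_
    have h2 : ContDiff ℝ 2 fun ξ : ℂ => z + L ξ := contDiff_const.add L.contDiff
    simp only [hLa] at h2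
    exact h2.contDiffAt
  · filter_upwards [hev.eventually_nhds] with ξ hξ
    obtain ⟨hU, hH⟩ := hξ.self_of_nhds
    rw [InnerProductSpace.laplacian_eq_iteratedFDeriv_complexPlane]
    simp only [iteratedFDeriv_two_apply, Matrix.cons_val_zero, Matrix.cons_val_one, Pi.zero_apply]
    have h1 : fderiv ℝ (fun ξ : ℂ => U (z + ξ • v)) =ᶠ[𝓝 ξ]
        fun η => (fderiv ℝ U (z + η • v)).comp L := by
      filter_upwards [hξ] with η hη
      exact ((hη.1.differentiableAt (by simp)).hasFDerivAt.comp η (haff η)).fderiv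
    have hB : HasFDerivAt (fderiv ℝ U) (fderiv ℝ (fderiv ℝ U) (z + ξ • v)) (z + ξ • v) :=
      ((hU.fderiv_right (m := 1) (by norm_num)).differentiableAt (by simp)).hasFDerivAt
    have h2 := (hB.comp ξ (haff ξ)).clm_comp (hasFDerivAt_const L ξ)
    rw [h1.fderiv_eq]
    erw [h2.fderiv]
    have hsymm : ∀ a b, fderiv ℝ (fderiv ℝ U) (z + ξ • v) a b
        = fderiv ℝ (fderiv ℝ U) (z + ξ • v) b a := fun a b =>
      (hU.isSymmSndFDerivAt (by simp)).eq a b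
    -- The Laplacian of the slice is four times the Levi form at (v, v), a combination of entries of
    -- the complex Hessian, all of which vanish.
    have h3 := leviForm_self _ hsymm v
    rw [leviForm_eq_sum] at h3
    simp only [← complexHessian_eq_leviForm hU, hH, Matrix.zero_apply, mul_zero,
      Finset.sum_const_zero] at h3
    have h4 := h3.symm
    rw [div_eq_zero_iff] at h4
    have h5 : fderiv ℝ (fderiv ℝ U) (z + ξ • v) v v
        + fderiv ℝ (fderiv ℝ U) (z + ξ • v) (Complex.I • v) (Complex.I • v) = 0 := by
      rcases h4 with h4 | h4
      · exact_mod_cast h4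
      · norm_num at h4
    simpa [hLa] using h5

end Levi

/-! ### Change of coordinates, flatness criteria and continuity of the curvature -/

section Charts

variable {n : ℕ} {M : Type*} [TopologicalSpace M] [ChartedSpace (Cn n) M]

/-- All tangent spaces are `Cn n` by definition, so vectors cross an equality of base points without
a cast. -/
theorem SesqField.congr_point (h : SesqField n M) {p q : M} (hpq : p = q) (v w : Cn n) :
    h p (show TangentSpace 𝓘(ℂ, Cn n) p from v) (show TangentSpace 𝓘(ℂ, Cn n) p from w)
      = h q (show TangentSpace 𝓘(ℂ, Cn n) q from v) (show TangentSpace 𝓘(ℂ, Cn n) q from w) := by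
  subst hpq; rfl

theorem coordVec_sum (φ : OpenPartialHomeomorph M (Cn n)) (z v : Cn n) :
    mfderiv 𝓘(ℂ, Cn n) 𝓘(ℂ, Cn n) φ.symm z v = ∑ i, v i • coordVec φ z i := by
  conv_lhs => rw [← sum_basisVec v]
  exact (map_sum _ _ _).trans (Finset.sum_congr rfl fun i _ => map_smul _ _ _)

theorem form_sum_sum {p : M} (h : TangentSpace 𝓘(ℂ, Cn n) p →ₗ[ℂ] TangentSpace 𝓘(ℂ, Cn n) p →ₗ⋆[ℂ] ℂ)
    (e : Fin n → TangentSpace 𝓘(ℂ, Cn n) p) (u v : Fin n → ℂ) :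
    h (∑ i, u i • e i) (∑ j, v j • e j) = ∑ i, ∑ j, u i * conj (v j) * h (e i) (e j) := by
  have hL : h (∑ i, u i • e i) = ∑ i, u i • h (e i) := by simp only [map_sum, map_smul]
  rw [hL, LinearMap.sum_apply]
  refine Finset.sum_congr rfl fun i _ => ?_
  rw [map_sum]
  refine Finset.sum_congr rfl fun j _ => ?_
  simp
  ring

theorem mdifferentiable_of_mem_holCharts {φ : OpenPartialHomeomorph M (Cn n)}
    (hφ : φ ∈ holCharts n M) : φ.MDifferentiable 𝓘(ℂ, Cn n) 𝓘(ℂ, Cn n) :=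
  ⟨(contMDiffOn_of_mem_maximalAtlas hφ).mdifferentiableOn (by simp),
    (contMDiffOn_symm_of_mem_maximalAtlas hφ).mdifferentiableOn (by simp)⟩

/-- The double sum is the metric evaluated on the image of v under the differential of the inverse
chart, which is injective. -/
theorem KahlerMetric.coeff_pos (g : KahlerMetric n M) {φ : OpenPartialHomeomorph M (Cn n)}
    (hφ : φ ∈ holCharts n M) {z : Cn n} (hz : z ∈ φ.target) {v : Cn n} (hv : v ≠ 0) :
    0 < (∑ i, ∑ j, v i * conj (v j) * coeff g.form φ z i j).re := by
  have h : ∑ i, ∑ j, v i * conj (v j) * coeff g.form φ z i j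
      = g.form (φ.symm z) (mfderiv 𝓘(ℂ, Cn n) 𝓘(ℂ, Cn n) φ.symm z v)
        (mfderiv 𝓘(ℂ, Cn n) 𝓘(ℂ, Cn n) φ.symm z v) := by
    rw [coordVec_sum, form_sum_sum]; rfl
  rw [h]
  refine g.pos _ _ fun h0 => hv ?_
  have := DFunLike.congr_fun ((mdifferentiable_of_mem_holCharts hφ).comp_symm_deriv hz) v
  exact this.symm.trans ((congrArg (mfderiv 𝓘(ℂ, Cn n) 𝓘(ℂ, Cn n) φ (φ.symm z)) h0).trans
    (map_zero _))

theorem KahlerMetric.coeff_conj (g : KahlerMetric n M) (φ : OpenPartialHomeomorph M (Cn n))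
    (z : Cn n) (i j : Fin n) : coeff g.form φ z i j = conj (coeff g.form φ z j i) :=
  g.hermitian _ _ _

/-- Transition maps between holomorphic coordinates are analytic. -/
theorem analyticAt_transition {φ ψ : OpenPartialHomeomorph M (Cn n)} (hφ : φ ∈ holCharts n M)
    (hψ : ψ ∈ holCharts n M) {z : Cn n} (hz : z ∈ ψ.target) (hz' : ψ.symm z ∈ φ.source) :
    AnalyticAt ℂ (fun w => φ (ψ.symm w)) z := by
  have h1 : ContMDiffAt 𝓘(ℂ, Cn n) 𝓘(ℂ, Cn n) ω φ (ψ.symm z) :=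
    (contMDiffOn_of_mem_maximalAtlas hφ).contMDiffAt (φ.open_source.mem_nhds hz')
  have h2 : ContMDiffAt 𝓘(ℂ, Cn n) 𝓘(ℂ, Cn n) ω ψ.symm z :=
    (contMDiffOn_symm_of_mem_maximalAtlas hψ).contMDiffAt (ψ.open_target.mem_nhds hz)
  have h3 := (h1.comp z h2).contDiffAt
  exact h3.analyticAt

/-- Chain rule for ψ⁻¹ = φ⁻¹ ∘ τ with τ the transition map, followed by sesquilinear expansion. -/
theorem coeff_change (h : SesqField n M) {φ ψ : OpenPartialHomeomorph M (Cn n)}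
    (hφ : φ ∈ holCharts n M) (hψ : ψ ∈ holCharts n M) {z : Cn n} (hz : z ∈ ψ.target)
    (hz' : ψ.symm z ∈ φ.source) (i j : Fin n) :
    coeff h ψ z i j = ∑ a, ∑ b, fderiv ℂ (fun w => φ (ψ.symm w)) z (basisVec i) a
      * conj (fderiv ℂ (fun w => φ (ψ.symm w)) z (basisVec j) b)
      * coeff h φ (φ (ψ.symm z)) a b := by
  set τ : Cn n → Cn n := fun w => φ (ψ.symm w) with hτ
  have hτd : DifferentiableAt ℂ τ z := (analyticAt_transition hφ hψ hz hz').differentiableAt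
  have hτz : τ z ∈ φ.target := φ.map_source hz'
  have hev : ψ.symm =ᶠ[𝓝 z] φ.symm ∘ τ := by
    have := (ψ.continuousAt_symm hz).eventually (φ.open_source.mem_nhds hz')
    filter_upwards [this] with w hw
    exact (φ.left_inv hw).symm
  have hd : ∀ v : Cn n, mfderiv 𝓘(ℂ, Cn n) 𝓘(ℂ, Cn n) ψ.symm z v
      = mfderiv 𝓘(ℂ, Cn n) 𝓘(ℂ, Cn n) φ.symm (τ z) (fderiv ℂ τ z v) := fun v => by
    have h1 : mfderiv 𝓘(ℂ, Cn n) 𝓘(ℂ, Cn n) ψ.symm z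
        = mfderiv 𝓘(ℂ, Cn n) 𝓘(ℂ, Cn n) (φ.symm ∘ τ) z := hev.mfderiv_eq
    rw [h1, mfderiv_comp z ((mdifferentiable_of_mem_holCharts hφ).mdifferentiableAt_symm hτz)
      hτd.mdifferentiableAt, mfderiv_eq_fderiv]
    rfl
  have hp : ψ.symm z = φ.symm (τ z) := (φ.left_inv hz').symm
  have key : coeff h ψ z i j = h (φ.symm (τ z))
      (mfderiv 𝓘(ℂ, Cn n) 𝓘(ℂ, Cn n) φ.symm (τ z) (fderiv ℂ τ z (basisVec i)))
      (mfderiv 𝓘(ℂ, Cn n) 𝓘(ℂ, Cn n) φ.symm (τ z) (fderiv ℂ τ z (basisVec j))) := by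
    rw [← hd, ← hd]
    exact SesqField.congr_point h hp _ _
  rw [key, coordVec_sum, coordVec_sum, form_sum_sum]
  rfl

/-- A metric of the form `c J Jᴴ` with `J` holomorphic has vanishing curvature. -/
theorem KahlerMetric.curvature_eq_zero_of_factorization (g : KahlerMetric n M)
    (ψ : OpenPartialHomeomorph M (Cn n)) {z : Cn n} {c : ℂ} (hc : c ≠ 0)
    {J : Cn n → Matrix (Fin n) (Fin n) ℂ} (hJ : ∀ i a, AnalyticAt ℂ (fun w => J w i a) z)
    (hdet : (J z).det ≠ 0)
    (hg : ∀ᶠ w in 𝓝 z, coeff g.form ψ w = c • (J w * (J w).conjTranspose)) (i j k l : Fin n) :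
    g.curvature ψ z i j k l = 0 := by
  set A : Fin n → Matrix (Fin n) (Fin n) ℂ := fun k => Matrix.of fun i a =>
    dz k (fun w => J w i a) z with hA
  have hev : ∀ᶠ w in 𝓝 z, ∀ i a, AnalyticAt ℂ (fun w => J w i a) w := by
    rw [eventually_all]; intro i
    rw [eventually_all]; intro a
    exact (hJ i a).eventually_analyticAt
  have hent : ∀ᶠ w in 𝓝 z, ∀ i l, coeff g.form ψ w i l = c * ∑ a, J w i a * conj (J w l a) := by
    filter_upwards [hg] with w hw i l
    rw [hw]
    simp [Matrix.mul_apply]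
  have hentf : ∀ i l, (fun w => coeff g.form ψ w i l)
      =ᶠ[𝓝 z] fun w => ∑ a, c * J w i a * conj (J w l a) := fun i l => by
    filter_upwards [hent] with w hw
    rw [hw, Finset.mul_sum]
    exact Finset.sum_congr rfl fun a _ => by ring
  have dR : ∀ {w}, (∀ i a, AnalyticAt ℂ (fun w => J w i a) w) → ∀ i a,
      DifferentiableAt ℝ (fun w => J w i a) w := fun h i a =>
    (h i a).differentiableAt.restrictScalars ℝ
  have dC : ∀ {w}, (∀ i a, AnalyticAt ℂ (fun w => J w i a) w) → ∀ i a,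
      DifferentiableAt ℝ (fun w => (conj (J w i a) : ℂ)) w := fun h i a =>
    (Complex.conjCLE : ℂ →L[ℝ] ℂ).differentiableAt.comp _ (dR h i a)
  have dcR : ∀ {w}, (∀ i a, AnalyticAt ℂ (fun w => J w i a) w) → ∀ i a,
      DifferentiableAt ℂ (fun w => c * J w i a) w := fun h i a =>
    (h i a).differentiableAt.const_mul c
  have hdz : ∀ k i l, dz k (fun w => coeff g.form ψ w i l) z
      = (c • (A k * (J z).conjTranspose)) i l := fun k i l => by
    rw [dz_congr (hentf i l), dz_sum _ fun a _ =>
      ((dcR hJ i a).restrictScalars ℝ).fun_mul (dC hJ l a)]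
    simp only [Matrix.smul_apply, Matrix.mul_apply, Matrix.conjTranspose_apply, smul_eq_mul,
      Finset.mul_sum]
    refine Finset.sum_congr rfl fun a _ => ?_
    rw [dz_mul ((dcR hJ i a).restrictScalars ℝ) (dC hJ l a), dz_conj (dR hJ l a),
      dzbar_of_differentiableAt (hJ l a).differentiableAt, dz_const_mul _ _ _ _ (dR hJ i a)]
    simp [hA]
    ring
  have hdzbar : ∀ j, ∀ᶠ w in 𝓝 z, ∀ i l, dzbar j (fun w => coeff g.form ψ w i l) w
      = ∑ a, c * J w i a * conj (dz j (fun w => J w l a) w) := fun j => by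
    filter_upwards [hent.eventually_nhds, hev] with w hw hJw i l
    have : (fun w => coeff g.form ψ w i l)
        =ᶠ[𝓝 w] fun w => ∑ a, c * J w i a * conj (J w l a) := by
      filter_upwards [hw] with w hw
      rw [hw, Finset.mul_sum]
      exact Finset.sum_congr rfl fun a _ => by ring
    rw [dzbar_congr this, dzbar_sum _ fun a _ =>
      ((dcR hJw i a).restrictScalars ℝ).fun_mul (dC hJw l a)]
    refine Finset.sum_congr rfl fun a _ => ?_
    rw [dzbar_mul ((dcR hJw i a).restrictScalars ℝ) (dC hJw l a), dzbar_conj (dR hJw l a),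
      dzbar_of_differentiableAt (dcR hJw i a)]
    ring
  have hdz' : ∀ j l a, DifferentiableAt ℂ (dz j fun w => J w l a) z := fun j l a => by
    have h1 : (dz j fun w => J w l a) =ᶠ[𝓝 z] fun w => fderiv ℂ (fun w => J w l a) w (basisVec j) := by
      filter_upwards [hev] with w hw
      exact dz_of_differentiableAt (hw l a).differentiableAt j
    exact ((hJ l a).fderiv.differentiableAt.clm_apply
      (differentiableAt_const _)).congr_of_eventuallyEq h1
  have hdd : dz k (dzbar j fun w => coeff g.form ψ w i l) z
      = (c • (A k * (A j).conjTranspose)) i l := by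
    have h1 : (dzbar j fun w => coeff g.form ψ w i l) =ᶠ[𝓝 z]
        fun w => ∑ a, c * J w i a * conj (dz j (fun w => J w l a) w) := by
      filter_upwards [hdzbar j] with w hw using hw i l
    have dC' : ∀ a, DifferentiableAt ℝ (fun w => (conj (dz j (fun w => J w l a) w) : ℂ)) z :=
      fun a => (Complex.conjCLE : ℂ →L[ℝ] ℂ).differentiableAt.comp _
        ((hdz' j l a).restrictScalars ℝ)
    rw [dz_congr h1, dz_sum _ fun a _ => ((dcR hJ i a).restrictScalars ℝ).fun_mul (dC' a)]
    simp only [Matrix.smul_apply, Matrix.mul_apply, Matrix.conjTranspose_apply, smul_eq_mul,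
      Finset.mul_sum]
    refine Finset.sum_congr rfl fun a _ => ?_
    rw [dz_mul ((dcR hJ i a).restrictScalars ℝ) (dC' a),
      dz_conj ((hdz' j l a).restrictScalars ℝ), dzbar_of_differentiableAt (hdz' j l a),
      dz_const_mul _ _ _ _ (dR hJ i a)]
    simp [hA]
    ring
  have hdb : ∀ q l, dzbar j (fun w => coeff g.form ψ w q l) z
      = (c • (J z * (A j).conjTranspose)) q l := fun q l => by
    rw [(hdzbar j).self_of_nhds q l]
    simp only [Matrix.smul_apply, Matrix.mul_apply, Matrix.conjTranspose_apply, smul_eq_mul,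
      Finset.mul_sum, hA, Matrix.of_apply]
    exact Finset.sum_congr rfl fun a _ => by simp; ring
  have hU : IsUnit (J z).det := isUnit_iff_ne_zero.2 hdet
  have hU' : IsUnit (J z).conjTranspose.det := by
    rw [Matrix.det_conjTranspose]; exact hU.star
  have hinv : (coeff g.form ψ z)⁻¹
      = c⁻¹ • ((J z).conjTranspose⁻¹ * (J z)⁻¹) := by
    refine Matrix.inv_eq_right_inv ?_
    rw [hg.self_of_nhds, Matrix.smul_mul, Matrix.mul_smul, smul_smul, mul_inv_cancel₀ hc, one_smul,
      Matrix.mul_assoc, ← Matrix.mul_assoc (J z).conjTranspose, Matrix.mul_nonsing_inv _ hU',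
      Matrix.one_mul, Matrix.mul_nonsing_inv _ hU]
  have hsum : ∑ p, ∑ q, (coeff g.form ψ z)⁻¹ p q *
      dz k (fun w => coeff g.form ψ w i p) z * dzbar j (fun w => coeff g.form ψ w q l) z
      = ((c • (A k * (J z).conjTranspose)) * (coeff g.form ψ z)⁻¹
          * (c • (J z * (A j).conjTranspose))) i l := by
    rw [Matrix.mul_assoc, Matrix.mul_apply]
    refine Finset.sum_congr rfl fun p _ => ?_
    rw [Matrix.mul_apply, Finset.mul_sum]
    refine Finset.sum_congr rfl fun q _ => ?_
    rw [hdz, hdb]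
    ring
  unfold KahlerMetric.curvature
  rw [hsum, hdd, hinv, sub_eq_zero]
  -- With Aₖ = ∂ₖJ, the second derivative is c Aₖ Aⱼᴴ. The correction term is c Aₖ Jᴴ (J Jᴴ)⁻¹ J
  -- Aⱼᴴ, in which the factors between Aₖ and Aⱼᴴ cancel.
  have h1 : (J z).conjTranspose * ((J z).conjTranspose⁻¹ * (J z)⁻¹) * J z = 1 := by
    rw [← Matrix.mul_assoc, Matrix.mul_nonsing_inv _ hU', Matrix.one_mul,
      Matrix.nonsing_inv_mul _ hU]
  have h2 : A k * (J z).conjTranspose * ((J z).conjTranspose⁻¹ * (J z)⁻¹)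
      * (J z * (A j).conjTranspose) = A k * (A j).conjTranspose := by
    rw [← Matrix.mul_assoc _ (J z), Matrix.mul_assoc (A k), Matrix.mul_assoc (A k), h1,
      Matrix.mul_one]
  simp only [Matrix.smul_mul, Matrix.mul_smul, smul_smul, h2]
  field_simp

/-- If the metric is a constant multiple of the Euclidean one in some coordinates, then its
curvature vanishes in all coordinates. -/
theorem KahlerMetric.curvature_eq_zero_of_eventually_const (g : KahlerMetric n M)
    {φ ψ : OpenPartialHomeomorph M (Cn n)} (hφ : φ ∈ holCharts n M) (hψ : ψ ∈ holCharts n M)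
    {z : Cn n} (hz : z ∈ ψ.target) (hz' : ψ.symm z ∈ φ.source) {c : ℂ} (hc : c ≠ 0)
    (hg : ∀ᶠ w in 𝓝 (φ (ψ.symm z)), coeff g.form φ w = c • (1 : Matrix (Fin n) (Fin n) ℂ))
    (i j k l : Fin n) : g.curvature ψ z i j k l = 0 := by
  have hτ := analyticAt_transition hφ hψ hz hz'
  set J : Cn n → Matrix (Fin n) (Fin n) ℂ := fun w => Matrix.of fun i a =>
    fderiv ℂ (fun w => φ (ψ.symm w)) w (basisVec i) a with hJ
  have hev : ∀ᶠ w in 𝓝 z, coeff g.form ψ w = c • (J w * (J w).conjTranspose) := by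
    filter_upwards [ψ.open_target.mem_nhds hz,
      (ψ.continuousAt_symm hz).eventually (φ.open_source.mem_nhds hz'),
      hτ.continuousAt.eventually hg] with w h1 h2 h3
    ext i j
    rw [coeff_change g.form hφ hψ h1 h2, h3]
    simp [Matrix.mul_apply, Matrix.one_apply, Finset.mul_sum, hJ]
    exact Finset.sum_congr rfl fun a _ => by ring
  refine g.curvature_eq_zero_of_factorization ψ hc (J := J) (fun i a => ?_) (fun h0 => ?_) hev
    i j k l
  · exact ((EuclideanSpace.proj (𝕜 := ℂ) a).analyticAt _).comp
      (((ContinuousLinearMap.apply ℂ (Cn n) (basisVec i)).analyticAt _).comp hτ.fderiv)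
  -- A left null vector of J would be a null vector of the metric, against positivity.
  · obtain ⟨v, hv, hvJ⟩ := Matrix.exists_vecMul_eq_zero_iff.2 h0
    have hpos := g.coeff_pos hψ hz (v := WithLp.toLp 2 v) (by simpa using hv)
    rw [hev.self_of_nhds] at hpos
    have : ∑ i, ∑ j, v i * conj (v j) * (c • (J z * (J z).conjTranspose)) i j
        = c * (Matrix.vecMul (Matrix.vecMul v (J z)) (J z).conjTranspose ⬝ᵥ star v) := by
      rw [Matrix.vecMul_vecMul]
      simp only [dotProduct, Matrix.vecMul, Finset.mul_sum, Finset.sum_mul, Pi.star_apply,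
        Matrix.smul_apply, smul_eq_mul]
      rw [Finset.sum_comm]
      refine Finset.sum_congr rfl fun a _ => Finset.sum_congr rfl fun b _ => ?_
      simp
      ring
    simp only [this, hvJ, Matrix.zero_vecMul, zero_dotProduct, mul_zero] at hpos
    simp at hpos

/-- The coefficients are smooth and, by positivity, form an invertible matrix. Continuity is what
carries flatness from a dense set to all points. -/
theorem KahlerMetric.continuousOn_curvature (g : KahlerMetric n M)
    {ψ : OpenPartialHomeomorph M (Cn n)} (hψ : ψ ∈ holCharts n M) (i j k l : Fin n) :
    ContinuousOn (fun z => g.curvature ψ z i j k l) ψ.target := by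
  intro z hz
  refine ContinuousAt.continuousWithinAt ?_
  have hs : ∀ a b, ContDiffAt ℝ ∞ (fun w => coeff g.form ψ w a b) z := fun a b =>
    (g.smooth ψ hψ a b).contDiffAt (ψ.open_target.mem_nhds hz)
  have hdet : (coeff g.form ψ z).det ≠ 0 := fun h0 => by
    obtain ⟨v, hv, hvG⟩ := Matrix.exists_vecMul_eq_zero_iff.2 h0
    have hpos := g.coeff_pos hψ hz (v := WithLp.toLp 2 v) (by simpa using hv)
    have : ∑ i, ∑ j, v i * conj (v j) * coeff g.form ψ z i j
        = Matrix.vecMul v (coeff g.form ψ z) ⬝ᵥ star v := by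
      simp only [dotProduct, Matrix.vecMul, Finset.sum_mul, Pi.star_apply]
      rw [Finset.sum_comm]
      refine Finset.sum_congr rfl fun a _ => Finset.sum_congr rfl fun b _ => ?_
      simp
      ring
    simp only [this, hvG, zero_dotProduct] at hpos
    simp at hpos
  have hG : ContinuousAt (fun w => coeff g.form ψ w) z :=
    continuousAt_pi.2 fun a => continuousAt_pi.2 fun b => (hs a b).continuousAt
  have hinv : ContinuousAt (fun w => (coeff g.form ψ w)⁻¹) z := by
    refine ContinuousAt.comp (g := fun A : Matrix (Fin n) (Fin n) ℂ => A⁻¹) ?_ hG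
    refine continuousAt_matrix_inv _ ?_
    rw [Ring.inverse_eq_inv']
    exact continuousAt_inv₀ hdet
  unfold KahlerMetric.curvature
  have h1 : ∀ a b m, ContDiffAt ℝ ∞ (dz m fun w => coeff g.form ψ w a b) z := fun a b m =>
    contDiffAt_dz (hs a b) (by simp) m
  have h2 : ∀ a b m, ContDiffAt ℝ ∞ (dzbar m fun w => coeff g.form ψ w a b) z := fun a b m =>
    contDiffAt_dzbar (hs a b) (by simp) m
  have h3 : ContDiffAt ℝ ∞ (dz k (dzbar j fun w => coeff g.form ψ w i l)) z :=
    contDiffAt_dz (h2 i l j) (by simp) k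
  refine h3.continuousAt.sub (tendsto_finsetSum _ fun p _ => tendsto_finsetSum _ fun q _ => ?_)
  have h4 : ContinuousAt (fun w => (coeff g.form ψ w)⁻¹ p q) z :=
    continuousAt_pi.1 (continuousAt_pi.1 hinv p) q
  exact (h4.mul (h1 i p k).continuousAt).mul (h2 q l j).continuousAt

end Charts

end KahlerGeom

/-! ### Smoothness of vector-valued holomorphic functions of several variables -/

section SeveralVariables

variable {E F : Type*} [NormedAddCommGroup E] [NormedSpace ℂ E] [NormedAddCommGroup F]
  [NormedSpace ℂ F]

/-- Cauchy's estimate in several variables. -/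
theorem norm_fderiv_le_of_ball {f : E → F} {w : E} {R C : ℝ} (hR : 0 < R)
    (hf : DifferentiableOn ℂ f (Metric.ball w R)) (hC : ∀ x ∈ Metric.ball w R, ‖f x‖ ≤ C) :
    ‖fderiv ℂ f w‖ ≤ 2 * C / R := by
  have hC0 : 0 ≤ C := (norm_nonneg _).trans (hC w (Metric.mem_ball_self hR))
  refine ContinuousLinearMap.opNorm_le_bound _ (by positivity) fun v => ?_
  rcases eq_or_ne v 0 with rfl | hv
  · simp
  have hv' : 0 < ‖v‖ := norm_pos_iff.2 hv
  set ρ : ℝ := R / (2 * ‖v‖) with hρ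
  have hρ0 : 0 < ρ := by positivity
  have hmem : ∀ t : ℂ, ‖t‖ ≤ ρ → w + t • v ∈ Metric.ball w R := fun t ht => by
    rw [mem_ball_iff_norm, add_sub_cancel_left, norm_smul]
    calc ‖t‖ * ‖v‖ ≤ ρ * ‖v‖ := by gcongr
      _ = R / 2 := by rw [hρ]; field_simp
      _ < R := by linarith
  have haff : ∀ t : ℂ, HasDerivAt (fun t : ℂ => w + t • v) v t := fun t => by
    simpa using ((hasDerivAt_id t).smul_const v).const_add w
  have hd : ∀ t : ℂ, ‖t‖ ≤ ρ →
      HasDerivAt (fun t : ℂ => f (w + t • v)) (fderiv ℂ f (w + t • v) v) t := fun t ht =>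
    ((hf.differentiableAt (Metric.isOpen_ball.mem_nhds (hmem t ht))).hasFDerivAt).comp_hasDerivAt t
      (haff t)
  have h1 := Complex.norm_deriv_le_of_forall_mem_sphere_norm_le (c := 0) (f := fun t : ℂ => f (w + t • v))
    hρ0 (C := C) (DifferentiableOn.diffContOnCl (fun t ht => by
      rw [closure_ball _ hρ0.ne', mem_closedBall_zero_iff] at ht
      exact (hd t ht).differentiableAt.differentiableWithinAt)) (fun t ht => by
      rw [mem_sphere_zero_iff_norm] at ht
      exact hC _ (hmem t ht.le))
  rw [(hd 0 (by simpa using hρ0.le)).deriv, zero_smul, add_zero] at h1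
  refine h1.trans (le_of_eq ?_)
  rw [hρ]
  field_simp

/-- The derivative of a holomorphic function is bounded and Lipschitz near every point. -/
theorem exists_ball_fderiv_continuousOn {f : E → F} {U : Set E} (hU : IsOpen U)
    (hf : DifferentiableOn ℂ f U) {w : E} (hw : w ∈ U) :
    ∃ r > 0, Metric.ball w r ⊆ U ∧ (∃ C, ∀ x ∈ Metric.ball w r, ‖fderiv ℂ f x‖ ≤ C) ∧
      ContinuousOn (fderiv ℂ f) (Metric.ball w r) := by
  obtain ⟨ε, hε, hball⟩ := Metric.isOpen_iff.1 hU w hw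
  have hc := (hf.differentiableAt (hU.mem_nhds hw)).continuousAt
  obtain ⟨η, hη, hbd⟩ := Metric.eventually_nhds_iff_ball.1
    (hc.norm.eventually (gt_mem_nhds (lt_add_one ‖f w‖)))
  set C := ‖f w‖ + 1 with hC
  -- The factor 4 leaves room for a base point within r of w, a displacement below r, and a Cauchy
  -- ball of radius r.
  set r := min ε η / 4 with hr
  have hr0 : 0 < r := by have := lt_min hε hη; positivity
  have hsub : ∀ x ∈ Metric.ball w (4 * r), x ∈ U ∧ ‖f x‖ ≤ C := fun x hx => by
    have h4 : 4 * r = min ε η := by rw [hr]; ring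
    rw [h4] at hx
    exact ⟨hball (Metric.ball_subset_ball (min_le_left _ _) hx),
      (hbd x (Metric.ball_subset_ball (min_le_right _ _) hx)).le⟩
  have hball' : ∀ {x y : E} {s t : ℝ}, x ∈ Metric.ball w s → y ∈ Metric.ball x t → s + t ≤ 4 * r →
      y ∈ Metric.ball w (4 * r) := fun {x y s t} hx hy hst => by
    rw [Metric.mem_ball] at *
    linarith [dist_triangle y x w]
  have hfd : ∀ x ∈ Metric.ball w (4 * r), DifferentiableAt ℂ f x := fun x hx =>
    hf.differentiableAt (hU.mem_nhds (hsub x hx).1)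
  have h1 : ∀ x ∈ Metric.ball w (3 * r), ‖fderiv ℂ f x‖ ≤ 2 * C / r := fun x hx =>
    norm_fderiv_le_of_ball hr0
      (fun y hy => (hfd y (hball' hx hy (by linarith))).differentiableWithinAt)
      fun y hy => (hsub y (hball' hx hy (by linarith))).2
  refine ⟨r, hr0, fun x hx => (hsub x (Metric.ball_subset_ball (by linarith) hx)).1,
    ⟨2 * C / r, fun x hx => h1 x (Metric.ball_subset_ball (by linarith) hx)⟩, ?_⟩
  have hlip : ∀ x ∈ Metric.ball w (3 * r), ∀ y ∈ Metric.ball w (3 * r),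
      ‖f y - f x‖ ≤ 2 * C / r * ‖y - x‖ := fun x hx y hy =>
    (convex_ball w (3 * r)).norm_image_sub_le_of_norm_fderiv_le (𝕜 := ℂ)
      (fun z hz => hfd z (Metric.ball_subset_ball (by linarith) hz)) h1 hx hy
  intro x hx
  refine ContinuousAt.continuousWithinAt ?_
  -- Cauchy's estimate for z ↦ f (z + h) - f z, which is O(‖h‖) by the Lipschitz bound on f.
  have hest : ∀ᶠ y in 𝓝 x, ‖fderiv ℂ f y - fderiv ℂ f x‖ ≤ 2 * (2 * C / r * ‖y - x‖) / r := by
    filter_upwards [Metric.ball_mem_nhds x hr0] with y hy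
    set h := y - x with hh
    have hmem : ∀ z ∈ Metric.ball x r, z ∈ Metric.ball w (3 * r) ∧ z + h ∈ Metric.ball w (3 * r) := by
      intro z hz
      rw [mem_ball_iff_norm] at hx hy hz ⊢
      rw [mem_ball_iff_norm]
      constructor
      · calc ‖z - w‖ = ‖(z - x) + (x - w)‖ := by congr 1; abel
          _ ≤ ‖z - x‖ + ‖x - w‖ := norm_add_le _ _
          _ < 3 * r := by linarith
      · calc ‖z + h - w‖ = ‖(z - x) + (x - w) + h‖ := by congr 1; abel
          _ ≤ ‖z - x‖ + ‖x - w‖ + ‖h‖ := norm_add₃_le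
          _ < 3 * r := by linarith
    have hd : ∀ z ∈ Metric.ball x r, HasFDerivAt (fun z => f (z + h) - f z)
        (fderiv ℂ f (z + h) - fderiv ℂ f z) z := fun z hz => by
      have h2 := (hfd _ (Metric.ball_subset_ball (by linarith) (hmem z hz).2)).hasFDerivAt
      have h3 := (hfd _ (Metric.ball_subset_ball (by linarith) (hmem z hz).1)).hasFDerivAt
      exact ((hasFDerivAt_comp_add_right h).2 h2).sub h3
    have h4 := norm_fderiv_le_of_ball hr0
      (fun z hz => (hd z hz).differentiableAt.differentiableWithinAt) fun z hz => by
        have := hlip z (hmem z hz).1 (z + h) (hmem z hz).2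
        rwa [add_sub_cancel_left] at this
    rw [(hd x (Metric.mem_ball_self hr0)).fderiv, hh, add_sub_cancel] at h4
    exact h4
  rw [ContinuousAt, tendsto_iff_norm_sub_tendsto_zero]
  refine squeeze_zero' (Eventually.of_forall fun _ => norm_nonneg _) hest ?_
  have hcont : Continuous fun y => 2 * (2 * C / r * ‖y - x‖) / r := by fun_prop
  simpa using hcont.tendsto x

/-- Cauchy's formula on a circle in the direction v writes the directional derivative as an integral
of values of f. This may be differentiated in w under the integral sign, as the derivative of f is
locally bounded and continuous. -/
theorem differentiableOn_fderiv_apply [CompleteSpace F] {f : E → F} {U : Set E}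
    (hU : IsOpen U) (hf : DifferentiableOn ℂ f U) (v : E) :
    DifferentiableOn ℂ (fun w => fderiv ℂ f w v) U := by
  intro w₀ hw₀
  refine DifferentiableAt.differentiableWithinAt ?_
  obtain ⟨r, hr, hrU, ⟨C, hC⟩, hcont⟩ := exists_ball_fderiv_continuousOn hU hf hw₀
  set ρ : ℝ := r / (2 * (‖v‖ + 1)) with hρ
  have hρ0 : 0 < ρ := by positivity
  have hρv : ρ * ‖v‖ ≤ r / 2 := by
    have h1 : ρ * (‖v‖ + 1) = r / 2 := by rw [hρ]; field_simp
    nlinarith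
  have hmem : ∀ w ∈ Metric.ball w₀ (r / 2), ∀ t : ℂ, ‖t‖ ≤ ρ → w + t • v ∈ Metric.ball w₀ r := by
    intro w hw t ht
    rw [mem_ball_iff_norm] at hw ⊢
    calc ‖w + t • v - w₀‖ = ‖(w - w₀) + t • v‖ := by congr 1; abel
      _ ≤ ‖w - w₀‖ + ‖t • v‖ := norm_add_le _ _
      _ ≤ ‖w - w₀‖ + ρ * ‖v‖ := by rw [norm_smul]; gcongr
      _ < r := by linarith
  have hfd : ∀ x ∈ Metric.ball w₀ r, DifferentiableAt ℂ f x := fun x hx =>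
    hf.differentiableAt (hU.mem_nhds (hrU hx))
  have hcauchy : ∀ w ∈ Metric.ball w₀ (r / 2), fderiv ℂ f w v =
      (2 * Real.pi * Complex.I : ℂ)⁻¹ • ∫ θ in (0 : ℝ)..2 * Real.pi,
        deriv (circleMap 0 ρ) θ • ((circleMap 0 ρ θ - 0) ^ 2)⁻¹ • f (w + circleMap 0 ρ θ • v) := by
    intro w hw
    have haff : HasDerivAt (fun t : ℂ => w + t • v) v 0 := by
      simpa using ((hasDerivAt_id (0 : ℂ)).smul_const v).const_add w
    have hVo : IsOpen ((fun t : ℂ => w + t • v) ⁻¹' Metric.ball w₀ r) :=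
      Metric.isOpen_ball.preimage (by fun_prop)
    have h1 := Complex.cderiv_eq_deriv (f := fun t : ℂ => f (w + t • v)) (z := 0) hVo
      (fun t ht => ((hfd _ ht).comp t (by fun_prop)).differentiableWithinAt) hρ0
      (fun t ht => hmem w hw t (by simpa using ht))
    have h2 : HasDerivAt (fun t : ℂ => f (w + t • v)) (fderiv ℂ f w v) 0 := by
      have h3 := (hfd w (Metric.ball_subset_ball (by linarith) hw)).hasFDerivAt
      refine HasFDerivAt.comp_hasDerivAt (x := (0 : ℂ)) (f := fun t : ℂ => w + t • v) ?_ haff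
      simpa using h3
    rw [h2.deriv] at h1
    rw [← h1]
    rfl
  have hcirc : Continuous fun θ => circleMap 0 ρ θ := continuous_circleMap 0 ρ
  have hk : Continuous fun θ => deriv (circleMap 0 ρ) θ * ((circleMap 0 ρ θ - 0) ^ 2)⁻¹ := by
    simp only [deriv_circleMap]
    refine (hcirc.mul continuous_const).mul (Continuous.inv₀ (by fun_prop) fun θ => ?_)
    simp [hρ0.ne']
  set k : ℝ → ℂ := fun θ => deriv (circleMap 0 ρ) θ * ((circleMap 0 ρ θ - 0) ^ 2)⁻¹ with hkdef
  have hmemc : ∀ w ∈ Metric.ball w₀ (r / 2), ∀ θ, w + circleMap 0 ρ θ • v ∈ Metric.ball w₀ r :=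
    fun w hw θ => hmem w hw _ (by simp [abs_of_pos hρ0])
  have hpath : ∀ w, Continuous fun θ => w + circleMap 0 ρ θ • v := fun w => by fun_prop
  have hFc : ∀ w ∈ Metric.ball w₀ (r / 2), Continuous fun θ => k θ • f (w + circleMap 0 ρ θ • v) := by
    intro w hw
    refine hk.smul (continuous_iff_continuousAt.2 fun θ => ?_)
    exact ContinuousAt.comp (g := f) (hfd _ (hmemc w hw θ)).continuousAt (hpath w).continuousAt
  have hF'c : Continuous fun θ => k θ • fderiv ℂ f (w₀ + circleMap 0 ρ θ • v) :=
    hk.smul (hcont.comp_continuous (hpath w₀)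
      (hmemc w₀ (Metric.mem_ball_self (by positivity))))
  have hmain := intervalIntegral.hasFDerivAt_integral_of_dominated_of_fderiv_le
    (μ := MeasureTheory.volume) (a := 0) (b := 2 * Real.pi) (𝕜 := ℂ)
    (F := fun w θ => k θ • f (w + circleMap 0 ρ θ • v))
    (F' := fun w θ => k θ • fderiv ℂ f (w + circleMap 0 ρ θ • v))
    (bound := fun θ => ‖k θ‖ * C) (x₀ := w₀)
    (Metric.ball_mem_nhds w₀ (half_pos hr))
    (eventually_of_mem (Metric.ball_mem_nhds w₀ (half_pos hr)) fun w hw =>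
      (hFc w hw).aestronglyMeasurable)
    ((hFc w₀ (Metric.mem_ball_self (half_pos hr))).intervalIntegrable _ _)
    hF'c.aestronglyMeasurable
    (Eventually.of_forall fun θ _ w hw => by
      rw [norm_smul]
      exact mul_le_mul_of_nonneg_left (hC _ (hmemc w hw θ)) (norm_nonneg _))
    ((hk.norm.mul continuous_const).intervalIntegrable _ _)
    (Eventually.of_forall fun θ _ w hw =>
      ((hasFDerivAt_comp_add_right (circleMap 0 ρ θ • v)).2
        (hfd _ (hmemc w hw θ)).hasFDerivAt).const_smul (k θ))
  refine DifferentiableAt.congr_of_eventuallyEq (hmain.differentiableAt.const_smul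
    (2 * Real.pi * Complex.I : ℂ)⁻¹) ?_
  filter_upwards [Metric.ball_mem_nhds w₀ (half_pos hr)] with w hw
  rw [hcauchy w hw]
  simp only [hkdef, smul_smul, Pi.smul_apply]

/-- Holomorphic functions of several complex variables are smooth. -/
theorem DifferentiableOn.contDiffOn_of_complex [FiniteDimensional ℂ E] [CompleteSpace F]
    {U : Set E} (hU : IsOpen U) (k : ℕ) {f : E → F} (hf : DifferentiableOn ℂ f U) :
    ContDiffOn ℂ k f U := by
  induction k generalizing f with
  | zero => exact contDiffOn_zero.2 hf.continuousOn
  | succ k ih =>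
    push_cast
    refine (contDiffOn_succ_iff_fderiv_of_isOpen hU).2 ⟨hf, by simp, ?_⟩
    -- In a finite-dimensional domain smoothness of the derivative is tested on each vector v, where
    -- the induction hypothesis applies.
    exact contDiffOn_clm_apply.2 fun v => ih (differentiableOn_fderiv_apply hU hf v)

end SeveralVariables

/-! ### The case of dimension one -/

namespace KahlerGeom

/-- In complex dimension one the curvature is `g ∂∂̄ log g`. -/
theorem KahlerMetric.isFlat_of_dim_one {M : Type*} [TopologicalSpace M] [ChartedSpace (Cn 1) M]
    (g : KahlerMetric 1 M) (hg : g.IsRicciFlat) : g.IsFlat := by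
  intro φ hφ z hz i j k l
  obtain rfl := Subsingleton.elim i 0
  obtain rfl := Subsingleton.elim j 0
  obtain rfl := Subsingleton.elim k 0
  obtain rfl := Subsingleton.elim l 0
  set u : Cn 1 → ℝ := fun w => (coeff g.form φ w 0 0).re with hu
  have hG : ∀ w, coeff g.form φ w 0 0 = u w := fun w =>
    (Complex.conj_eq_iff_re.1 (g.coeff_conj φ w 0 0).symm).symm
  have hpos : ∀ w ∈ φ.target, 0 < u w := fun w hw => by
    have := g.coeff_pos hφ hw (v := basisVec 0) (by
      intro h; simpa [basisVec] using congrArg (fun v : Cn 1 => v 0) h)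
    simpa [basisVec] using this
  have hs : ContDiffOn ℝ ∞ u φ.target := fun w hw =>
    Complex.reCLM.contDiff.contDiffAt.comp_contDiffWithinAt w (g.smooth φ hφ 0 0 w hw)
  have hsa : ∀ w ∈ φ.target, ContDiffAt ℝ ∞ u w := fun w hw =>
    hs.contDiffAt (φ.open_target.mem_nhds hw)
  have hud : ∀ w ∈ φ.target, DifferentiableAt ℝ u w := fun w hw =>
    (hsa w hw).differentiableAt (by simp)
  have huC : ContDiffAt ℝ ∞ (fun w => (u w : ℂ)) z :=
    Complex.ofRealCLM.contDiff.contDiffAt.comp z (hsa z hz)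
  have hric := congrFun (congrFun (hg φ hφ z hz) 0) 0
  simp only [Matrix.det_fin_one, complexHessian, Matrix.of_apply, Matrix.zero_apply] at hric
  have h1 : (dzbar 0 fun w => ((Real.log (u w) : ℝ) : ℂ)) =ᶠ[𝓝 z]
      fun w => (((u w)⁻¹ : ℝ) : ℂ) * dzbar 0 (fun w => (u w : ℂ)) w := by
    filter_upwards [φ.open_target.mem_nhds hz] with w hw
    exact dzbar_ofReal_comp (Real.hasDerivAt_log (hpos w hw).ne') (hud w hw) 0
  have hinv : DifferentiableAt ℝ (fun w => (((u w)⁻¹ : ℝ) : ℂ)) z :=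
    Complex.ofRealCLM.differentiableAt.comp z ((hud z hz).inv (hpos z hz).ne')
  have h2 : DifferentiableAt ℝ (dzbar 0 fun w => (u w : ℂ)) z :=
    (contDiffAt_dzbar (k := 1) huC (by norm_cast) 0).differentiableAt (by simp)
  change dz 0 (dzbar 0 fun w => ((Real.log (u w) : ℝ) : ℂ)) z = 0 at hric
  rw [dz_congr h1, dz_mul hinv h2,
    dz_ofReal_comp (hasDerivAt_inv (hpos z hz).ne') (hud z hz)] at hric
  have hne : (u z : ℂ) ≠ 0 := by exact_mod_cast (hpos z hz).ne'
  unfold KahlerMetric.curvature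
  have hGi : (coeff g.form φ z)⁻¹ 0 0 = (u z : ℂ)⁻¹ := by
    have : coeff g.form φ z * Matrix.diagonal (fun _ => (u z : ℂ)⁻¹) = 1 := by
      ext a b
      obtain rfl := Subsingleton.elim a 0
      obtain rfl := Subsingleton.elim b 0
      simp [hG, hne]
    rw [Matrix.inv_eq_right_inv this, Matrix.diagonal_apply_eq]
  simp only [Finset.univ_unique, Fin.default_eq_zero, Finset.sum_singleton, hGi, hG]
  -- Multiplying ∂∂̄ log u = 0 by u gives ∂∂̄u - u⁻¹ ∂u ∂̄u = 0, the curvature expression.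
  have h3 := congrArg (fun x => (u z : ℂ) * x) hric
  simp only [mul_zero] at h3
  rw [← h3]
  push_cast
  field_simp
  ring

/-! ### Linear algebra and regularity of radial potentials -/

section Radial

variable {n : ℕ}

theorem norm_sq_eq_sum_mul_conj (z : Cn n) : ∑ i, z i * conj (z i) = ((‖z‖ ^ 2 : ℝ) : ℂ) :=
  (ofReal_norm_sq_eq_sum z).symm

/-- The span of z has dimension at most 1 < n. Orthogonal directions see only the coefficient of δᵢⱼ
in a radial Hessian, and moving by ζ v changes |z|² exactly by |ζ|². -/
theorem exists_orthogonal_unit (hn : 2 ≤ n) (z : Cn n) :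
    ∃ v : Cn n, ‖v‖ = 1 ∧ inner ℂ z v = 0 := by
  have h1 : Module.finrank ℂ (Submodule.span ℂ {z} : Submodule ℂ (Cn n)) ≤ 1 :=
    (finrank_span_le_card ({z} : Set (Cn n))).trans (by simp)
  have h2 := Submodule.finrank_add_finrank_orthogonal (𝕜 := ℂ) (Submodule.span ℂ {z} : Submodule ℂ (Cn n))
  rw [finrank_euclideanSpace_fin] at h2
  have h3 : 0 < Module.finrank ℂ (Submodule.span ℂ {z} : Submodule ℂ (Cn n))ᗮ := by omega
  obtain ⟨⟨v, hv⟩, hv0⟩ := Module.finrank_pos_iff_exists_ne_zero.1 h3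
  have hv0' : v ≠ 0 := fun h => hv0 (by simpa using h)
  refine ⟨((‖v‖ : ℂ)⁻¹) • v, by simp [norm_smul, hv0'], ?_⟩
  rw [inner_smul_right, Submodule.mem_orthogonal_singleton_iff_inner_right.1 hv, mul_zero]

theorem inner_eq_sum (z v : Cn n) : inner ℂ z v = ∑ i, v i * conj (z i) := by
  simp [PiLp.inner_apply]

/-- The matrix `a δᵢⱼ + b z̄ᵢ zⱼ` as a Hermitian form. -/
theorem sum_radial (a b : ℂ) (z v : Cn n) :
    ∑ i, ∑ j, v i * conj (v j) * (a * (if i = j then 1 else 0) + b * (conj (z i) * z j))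
      = a * (‖v‖ ^ 2 : ℝ) + b * (inner ℂ z v * conj (inner ℂ z v)) := by
  have h1 : ∀ i, ∑ j, v i * conj (v j) * (a * (if i = j then 1 else 0) + b * (conj (z i) * z j))
      = a * (v i * conj (v i)) + b * (v i * conj (z i)) * conj (inner ℂ z v) := fun i => by
    simp only [mul_add, Finset.sum_add_distrib, mul_ite, mul_one, mul_zero, Finset.sum_ite_eq,
      Finset.mem_univ, if_true]
    rw [inner_eq_sum, map_sum, Finset.mul_sum]
    congr 1
    · ring
    · exact Finset.sum_congr rfl fun j _ => by simp; ring
  simp only [h1, Finset.sum_add_distrib]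
  rw [← Finset.mul_sum, norm_sq_eq_sum_mul_conj, ← Finset.sum_mul, ← Finset.mul_sum,
    ← inner_eq_sum]
  ring

/-- Determinant of a rank-one perturbation of a scalar matrix, after factoring out a. -/
theorem det_radial {a b : ℂ} (ha : a ≠ 0) (hn : n ≠ 0) (z : Cn n) :
    (Matrix.of fun i j : Fin n => a * (if i = j then 1 else 0) + b * (conj (z i) * z j)).det
      = a ^ (n - 1) * (a + b * (‖z‖ ^ 2 : ℝ)) := by
  have h1 : (Matrix.of fun i j : Fin n => a * (if i = j then 1 else 0) + b * (conj (z i) * z j))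
      = a • (1 + Matrix.replicateCol Unit (fun i => b / a * conj (z i))
          * Matrix.replicateRow Unit (fun j => z j)) := by
    ext i j
    rw [Matrix.smul_apply, Matrix.add_apply, Matrix.mul_apply]
    simp only [Matrix.of_apply, Matrix.one_apply, Finset.univ_unique, Finset.sum_singleton,
      Matrix.replicateCol_apply, Matrix.replicateRow_apply, smul_eq_mul]
    field_simp
  rw [h1, Matrix.det_smul, Matrix.det_one_add_replicateCol_mul_replicateRow, Fintype.card_fin]
  have h2 : (fun j => z j) ⬝ᵥ (fun i => b / a * conj (z i)) = b / a * (‖z‖ ^ 2 : ℝ) := by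
    rw [← norm_sq_eq_sum_mul_conj, Finset.mul_sum]
    exact Finset.sum_congr rfl fun i _ => by ring
  rw [h2]
  obtain ⟨m, rfl⟩ := Nat.exists_eq_succ_of_ne_zero hn
  simp only [Nat.succ_eq_add_one, Nat.add_sub_cancel, pow_succ]
  field_simp

/-- The ray through `z₀`, parametrised by the square of the norm. -/
theorem exists_ray {z₀ : Cn n} (hz₀ : z₀ ≠ 0) : ∃ γ : ℝ → Cn n, γ (‖z₀‖ ^ 2) = z₀ ∧
    (∀ r, 0 ≤ r → ‖γ r‖ ^ 2 = r) ∧ ContDiffAt ℝ ∞ γ (‖z₀‖ ^ 2) := by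
  have h0 : 0 < ‖z₀‖ := norm_pos_iff.2 hz₀
  refine ⟨fun r => (Real.sqrt r / ‖z₀‖) • z₀, ?_, fun r hr => ?_, ?_⟩
  · dsimp only
    rw [Real.sqrt_sq h0.le, div_self h0.ne', one_smul]
  · rw [norm_smul, Real.norm_of_nonneg (by positivity), div_mul_cancel₀ _ h0.ne', Real.sq_sqrt hr]
  · exact ((Real.contDiffAt_sqrt (by positivity)).div_const _).smul contDiffAt_const

/-- A property of `‖w‖²` that holds for all `w` near `z₀` holds near `‖z₀‖²`. -/
theorem eventually_norm_sq {z₀ : Cn n} (hz₀ : z₀ ≠ 0) {P : ℝ → Prop}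
    (h : ∀ᶠ w in 𝓝 z₀, P (‖w‖ ^ 2)) : ∀ᶠ r in 𝓝 (‖z₀‖ ^ 2), P r := by
  obtain ⟨γ, h1, h2, h3⟩ := exists_ray hz₀
  have h4 : 0 < ‖z₀‖ ^ 2 := by have := norm_pos_iff.2 hz₀; positivity
  have h5 : Tendsto γ (𝓝 (‖z₀‖ ^ 2)) (𝓝 z₀) := by
    simpa only [h1] using h3.continuousAt.tendsto
  filter_upwards [h5.eventually h, lt_mem_nhds h4] with r hr hr0
  rwa [h2 r hr0.le] at hr

/-- Restrict to the ray r ↦ √r z₀ / ‖z₀‖, which is smooth away from r = 0. -/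
theorem contDiffAt_of_radial {f : ℝ → ℝ} {z₀ : Cn n} (hz₀ : z₀ ≠ 0)
    (h : ContDiffAt ℝ ∞ (fun w : Cn n => f (‖w‖ ^ 2)) z₀) : ContDiffAt ℝ ∞ f (‖z₀‖ ^ 2) := by
  obtain ⟨γ, h1, h2, h3⟩ := exists_ray hz₀
  have h4 : 0 < ‖z₀‖ ^ 2 := by have := norm_pos_iff.2 hz₀; positivity
  rw [← h1] at h
  refine (h.comp _ h3).congr_of_eventuallyEq ?_
  filter_upwards [lt_mem_nhds h4] with r hr
  simp [h2 r hr.le]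

end Radial

/-! ### Radial Ricci-flat metrics and their Kähler immersions -/

section RadialMetric

variable {n : ℕ} {M : Type*} [TopologicalSpace M] [ChartedSpace (Cn n) M]

/-- Positivity of a radial metric. -/
theorem KahlerMetric.radial_pos (g : KahlerMetric n M) (hn : 2 ≤ n)
    {φ : OpenPartialHomeomorph M (Cn n)} (hφ : φ ∈ holCharts n M) {z : Cn n} (hz : z ∈ φ.target)
    (hz0 : z ≠ 0) {a b : ℝ} (hg : ∀ i j, coeff g.form φ z i j
      = a * (if i = j then 1 else 0) + b * (conj (z i) * z j)) :
    0 < a ∧ 0 < a + b * ‖z‖ ^ 2 := by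
  constructor
  · obtain ⟨v, hv1, hv⟩ := exists_orthogonal_unit hn z
    have h := g.coeff_pos hφ hz (v := v) (by rintro rfl; simp at hv1)
    simp only [hg] at h
    rw [sum_radial, hv, hv1] at h
    simpa using h
  · have h := g.coeff_pos hφ hz (v := z) hz0
    simp only [hg] at h
    rw [sum_radial, inner_self_eq_norm_sq_to_K] at h
    have h0 : 0 < ‖z‖ ^ 2 := by have := norm_pos_iff.2 hz0; positivity
    have h1 : ((a : ℂ) * (‖z‖ ^ 2 : ℝ) + b * ((‖z‖ : ℂ) ^ 2 * conj ((‖z‖ : ℂ) ^ 2)))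
        = ((‖z‖ ^ 2 * (a + b * ‖z‖ ^ 2) : ℝ) : ℂ) := by
      simp
      ring
    erw [h1, Complex.ofReal_re] at h
    exact (pos_iff_pos_of_mul_pos h).1 h0

/-- The first integral `(r f')ⁿ = c rⁿ + b` of the Ricci-flat equation for radial metrics. -/
theorem KahlerMetric.radial_ode (g : KahlerMetric n M) (hn : 2 ≤ n) (hric : g.IsRicciFlat)
    {φ : OpenPartialHomeomorph M (Cn n)} (hφ : φ ∈ holCharts n M) {f : ℝ → ℝ} {z₀ : Cn n}
    (hz₀ : z₀ ∈ φ.target) (h0 : z₀ ≠ 0) (hf : ContDiffAt ℝ ∞ f (‖z₀‖ ^ 2))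
    (hg : ∀ᶠ z in 𝓝 z₀, coeff g.form φ z = complexHessian (fun w => f (‖w‖ ^ 2)) z) :
    (∀ᶠ r in 𝓝 (‖z₀‖ ^ 2), 0 < deriv f r) ∧ ∃ c b : ℝ, 0 < c ∧
      ∀ᶠ r in 𝓝 (‖z₀‖ ^ 2), (r * deriv f r) ^ n = c * r ^ n + b := by
  have hr0 : 0 < ‖z₀‖ ^ 2 := by have := norm_pos_iff.2 h0; positivity
  have hfd : ContDiffAt ℝ ∞ (deriv f) (‖z₀‖ ^ 2) := ContDiffAt.derivWithin hf (by simp)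
  have hfdd : ContDiffAt ℝ ∞ (deriv (deriv f)) (‖z₀‖ ^ 2) := ContDiffAt.derivWithin hfd (by simp)
  have hnorm : Tendsto (fun w : Cn n => ‖w‖ ^ 2) (𝓝 z₀) (𝓝 (‖z₀‖ ^ 2)) :=
    (continuous_norm.pow 2).tendsto z₀
  have hf2 : ContDiffAt ℝ 2 f (‖z₀‖ ^ 2) := hf.of_le (by norm_cast)
  have hcoeff : ∀ᶠ z in 𝓝 z₀, ∀ i j, coeff g.form φ z i j
      = (deriv f (‖z‖ ^ 2) : ℝ) * (if i = j then 1 else 0)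
        + (deriv (deriv f) (‖z‖ ^ 2) : ℝ) * (conj (z i) * z j) := by
    filter_upwards [hg, hnorm.eventually (hf2.eventually (by simp))] with z h1 h2 i j
    rw [h1, complexHessian_radial h2]
  have hpos : ∀ᶠ z in 𝓝 z₀, 0 < deriv f (‖z‖ ^ 2) ∧
      0 < deriv f (‖z‖ ^ 2) + deriv (deriv f) (‖z‖ ^ 2) * ‖z‖ ^ 2 := by
    filter_upwards [hcoeff, φ.open_target.mem_nhds hz₀, eventually_ne_nhds h0] with z h1 h2 h3
    exact g.radial_pos hn hφ h2 h3 h1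
  set h : ℝ → ℝ := fun r => deriv f r ^ (n - 1) * (deriv f r + deriv (deriv f) r * r) with hh
  have hhs : ContDiffAt ℝ ∞ h (‖z₀‖ ^ 2) :=
    (hfd.pow _).mul (hfd.add (hfdd.mul contDiffAt_id))
  have hdet : ∀ᶠ z in 𝓝 z₀, (coeff g.form φ z).det.re = h (‖z‖ ^ 2) := by
    filter_upwards [hcoeff, hpos] with z h1 h2
    have h3 : coeff g.form φ z = Matrix.of fun i j : Fin n =>
        ((deriv f (‖z‖ ^ 2) : ℝ) : ℂ) * (if i = j then 1 else 0)
          + ((deriv (deriv f) (‖z‖ ^ 2) : ℝ) : ℂ) * (conj (z i) * z j) := by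
      ext i j; exact h1 i j
    rw [h3, det_radial (by exact_mod_cast h2.1.ne') (by omega)]
    rw [← Complex.ofReal_re (h (‖z‖ ^ 2))]
    congr 1
    simp only [hh]
    push_cast
    ring
  have hposr := eventually_norm_sq h0 (P := fun r => 0 < deriv f r ∧
      0 < deriv f r + deriv (deriv f) r * r) hpos
  have hhpos : 0 < h (‖z₀‖ ^ 2) :=
    mul_pos (pow_pos hposr.self_of_nhds.1 _) hposr.self_of_nhds.2
  set ℓ : ℝ → ℝ := fun r => Real.log (h r) with hℓ
  have hℓs : ContDiffAt ℝ 2 ℓ (‖z₀‖ ^ 2) := (hhs.of_le (by norm_cast)).log hhpos.ne'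
  have hℓ0 : ∀ᶠ r in 𝓝 (‖z₀‖ ^ 2), deriv ℓ r = 0 := by
    refine eventually_norm_sq h0 ?_
    filter_upwards [hdet.eventually_nhds, φ.open_target.mem_nhds hz₀,
      hnorm.eventually (hℓs.eventually (by simp))] with z h1 h2 h3
    have h4 := hric φ hφ z h2
    have h5 : complexHessian (fun w => Real.log (coeff g.form φ w).det.re) z
        = complexHessian (fun w => ℓ (‖w‖ ^ 2)) z := by
      ext i j
      refine dz_congr (eventually_dzbar_congr ?_ j) i
      filter_upwards [h1] with w hw
      rw [hw]
    rw [h5] at h4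
    -- On a unit vector orthogonal to z the vanishing Hermitian form of ℓ(|z|²) reduces to ℓ'(|z|²).
    obtain ⟨v, hv1, hv⟩ := exists_orthogonal_unit hn z
    have h6 := sum_radial (deriv ℓ (‖z‖ ^ 2) : ℝ) (deriv (deriv ℓ) (‖z‖ ^ 2) : ℝ) z v
    simp only [← complexHessian_radial h3, h4, hv, hv1] at h6
    simpa using h6.symm
  have hℓd : ∀ᶠ r in 𝓝 (‖z₀‖ ^ 2), HasDerivAt ℓ 0 r := by
    filter_upwards [hℓ0, hℓs.eventually (by simp)] with r h1 h2
    rw [← h1]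
    exact (h2.differentiableAt (by simp)).hasDerivAt
  set c : ℝ := h (‖z₀‖ ^ 2) with hc
  have hhc : ∀ᶠ r in 𝓝 (‖z₀‖ ^ 2), h r = c := by
    filter_upwards [eventually_eq_of_deriv_eq_zero hℓd, hposr] with r h1 h2
    exact Real.log_injOn_pos (mul_pos (pow_pos h2.1 _) h2.2) hhpos h1
  -- The derivative is n rⁿ⁻¹ (h - c), and h = c.
  have hder : ∀ᶠ r in 𝓝 (‖z₀‖ ^ 2), HasDerivAt (fun r => (r * deriv f r) ^ n - c * r ^ n) 0 r := by
    filter_upwards [hhc, (hfd.of_le (m := 1) (by norm_cast)).eventually (by simp)] with r h1 h2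
    have h3 : HasDerivAt (deriv f) (deriv (deriv f) r) r :=
      (h2.differentiableAt (by simp)).hasDerivAt
    have h4 := (((hasDerivAt_id r).mul h3).pow n).sub ((hasDerivAt_pow n r).const_mul c)
    refine h4.congr_deriv ?_
    simp only [Pi.mul_apply, id]
    rw [← h1, hh]
    simp only [mul_pow]
    ring
  refine ⟨hposr.mono fun r hr => hr.1, c, (‖z₀‖ ^ 2 * deriv f (‖z₀‖ ^ 2)) ^ n - c * (‖z₀‖ ^ 2) ^ n,
    hhpos, ?_⟩
  filter_upwards [eventually_eq_of_deriv_eq_zero hder] with r hr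
  linarith

/-- In radial coordinates, the exponential of the potential of a projectively induced metric has a
power series expansion with nonnegative coefficients. -/
theorem KahlerMetric.exists_radial_expansion (g : KahlerMetric n M) (hn : 2 ≤ n)
    (hproj : g.IsProjectivelyInduced) {φ : OpenPartialHomeomorph M (Cn n)}
    (hφ : φ ∈ holCharts n M) {f : ℝ → ℝ} {z₀ : Cn n} (hz₀ : z₀ ∈ φ.target)
    (hf : ∀ᶠ z in 𝓝 z₀, ContDiffAt ℝ 2 (fun w : Cn n => f (‖w‖ ^ 2)) z)
    (hg : ∀ᶠ z in 𝓝 z₀, coeff g.form φ z = complexHessian (fun w => f (‖w‖ ^ 2)) z) :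
    ∃ a : ℕ → ℝ, (∀ k, 0 ≤ a k) ∧ ∃ δ > 0, ∀ x ∈ Ico 0 δ,
      HasSum (fun k => a k * x ^ k) (Real.exp (f (‖z₀‖ ^ 2 + x))) := by
  obtain ⟨N, F, hF⟩ := hproj
  obtain ⟨V, hV, hpV, s, hs, hs0, hsg⟩ := hF (φ.symm z₀)
  set W : Set (Cn n) := φ.target ∩ φ.symm ⁻¹' V with hW
  have hWo : IsOpen W := φ.isOpen_inter_preimage_symm hV
  set S : Cn n → HomCoords N := fun w => s (φ.symm w) with hS
  have hSd : DifferentiableOn ℂ S W := by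
    rw [← mdifferentiableOn_iff_differentiableOn]
    exact hs.comp ((mdifferentiable_of_mem_holCharts hφ).2.mono
      inter_subset_left) fun w hw => hw.2
  have hS0 : ∀ w ∈ W, S w ≠ 0 := fun w hw => (hs0 _ hw.2).1
  have hlog : ∀ w ∈ W, ContDiffAt ℝ 2 (fun w => Real.log (‖S w‖ ^ 2)) w := fun w hw => by
    have h1 : ContDiffAt ℝ 2 S w :=
      ((hSd.contDiffOn_of_complex hWo 2).contDiffAt (hWo.mem_nhds hw)).restrict_scalars ℝ
    have h2 : 0 < ‖S w‖ := norm_pos_iff.2 (hS0 w hw)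
    exact (h1.norm_sq ℂ).log (by positivity)
  -- Both f(|w|²) and log ‖S‖² are potentials of the metric, so their difference is pluriharmonic.
  have hU : ∀ᶠ w in 𝓝 z₀, w ∈ W ∧ ContDiffAt ℝ 2 (fun w => f (‖w‖ ^ 2) - Real.log (‖S w‖ ^ 2)) w ∧
      complexHessian (fun w => f (‖w‖ ^ 2) - Real.log (‖S w‖ ^ 2)) w = 0 := by
    filter_upwards [hf, hg, hWo.mem_nhds ⟨hz₀, hpV⟩] with w h1 h2 h3
    refine ⟨h3, h1.sub (hlog w h3), ?_⟩
    rw [complexHessian_sub h1 (hlog w h3), ← h2, hsg φ hφ w h3.1 h3.2, sub_self]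
  obtain ⟨δ, hδ, hball⟩ := Metric.eventually_nhds_iff_ball.1 hU
  obtain ⟨v, hv1, hv⟩ := exists_orthogonal_unit hn z₀
  have hmem : ∀ ζ ∈ Metric.ball (0 : ℂ) δ, z₀ + ζ • v ∈ Metric.ball z₀ δ := fun ζ hζ => by
    rw [mem_ball_iff_norm, add_sub_cancel_left, norm_smul, hv1, mul_one]
    simpa using hζ
  have hnorm : ∀ ζ : ℂ, ‖z₀ + ζ • v‖ ^ 2 = ‖z₀‖ ^ 2 + ‖ζ‖ ^ 2 := fun ζ => by
    have h1 : inner ℂ z₀ (ζ • v) = 0 := by rw [inner_smul_right, hv, mul_zero]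
    have := norm_add_sq_eq_norm_sq_add_norm_sq_of_inner_eq_zero z₀ (ζ • v) h1
    rw [norm_smul, hv1, mul_one] at this
    simpa only [← pow_two] using this
  obtain ⟨a, ha, hsum⟩ := exists_nonneg_expansion_of_harmonic (δ := δ)
    (S := fun ζ : ℂ => S (z₀ + ζ • v)) (g := fun x => f (‖z₀‖ ^ 2 + x))
    (fun ζ hζ => by
      have h1 := hSd.differentiableAt (hWo.mem_nhds (hball _ (hmem ζ hζ)).1)
      exact (h1.comp ζ (f := fun ζ : ℂ => z₀ + ζ • v) (by fun_prop)).differentiableWithinAt)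
    (fun ζ hζ => hS0 _ (hball _ (hmem ζ hζ)).1)
    (fun ζ hζ => by
      have h1 := harmonicAt_slice (z := z₀) (v := v) (ζ := ζ)
        (U := fun w => f (‖w‖ ^ 2) - Real.log (‖S w‖ ^ 2))
        (eventually_of_mem (Metric.isOpen_ball.mem_nhds (hmem ζ hζ)) fun w hw => (hball w hw).2)
      simpa only [hnorm] using h1)
  -- The series is in x = |ζ|², so a disc of radius δ in ζ gives the range x < δ².
  refine ⟨a, ha, δ ^ 2, by positivity, fun x hx => ?_⟩
  have h1 := hsum (Real.sqrt x) ⟨Real.sqrt_nonneg x, (Real.sqrt_lt' hδ).2 hx.2⟩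
  rwa [Real.sq_sqrt hx.1] at h1

/-- A Ricci-flat projectively induced metric is a multiple of the Euclidean metric near every point
but the origin of a radial coordinate system. -/
theorem KahlerMetric.eventually_const_of_radial (g : KahlerMetric n M) (hn : 2 ≤ n)
    (hric : g.IsRicciFlat) (hproj : g.IsProjectivelyInduced)
    {φ : OpenPartialHomeomorph M (Cn n)} (hφ : φ ∈ holCharts n M) (hrad : g.IsRadialIn φ)
    {z₀ : Cn n} (hz₀ : z₀ ∈ φ.target) (h0 : z₀ ≠ 0) :
    ∃ c : ℂ, c ≠ 0 ∧ ∀ᶠ w in 𝓝 z₀, coeff g.form φ w = c • (1 : Matrix (Fin n) (Fin n) ℂ) := by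
  obtain ⟨f, hfs, hgf⟩ := hrad
  have hfsa : ∀ z ∈ φ.target, ContDiffAt ℝ ∞ (fun w : Cn n => f (‖w‖ ^ 2)) z := fun z hz =>
    hfs.contDiffAt (φ.open_target.mem_nhds hz)
  have hr0 : 0 < ‖z₀‖ ^ 2 := by have := norm_pos_iff.2 h0; positivity
  have hf := contDiffAt_of_radial h0 (hfsa z₀ hz₀)
  have hg : ∀ᶠ z in 𝓝 z₀, coeff g.form φ z = complexHessian (fun w => f (‖w‖ ^ 2)) z :=
    eventually_of_mem (φ.open_target.mem_nhds hz₀) hgf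
  obtain ⟨hpos, c, b, hc, hode⟩ := g.radial_ode hn hric hφ hz₀ h0 hf hg
  obtain ⟨a, ha, δ, hδ, hsum⟩ := g.exists_radial_expansion hn hproj hφ hz₀
    (eventually_of_mem (φ.open_target.mem_nhds hz₀) fun z hz => (hfsa z hz).of_le (by norm_cast)) hg
  have hfd : ∀ᶠ r in 𝓝 (‖z₀‖ ^ 2), HasDerivAt f (deriv f r) r := by
    filter_upwards [(hf.of_le (m := 1) (by norm_cast)).eventually (by simp)] with r hr
    exact (hr.differentiableAt (by simp)).hasDerivAt
  obtain rfl : b = 0 := eq_zero_of_nonneg_expansion hn hc hr0 hδ hfd hpos hode ha hsum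
  -- With b = 0 the equation reads f'ⁿ = c, and positivity of f' selects a single root.
  have hconst : ∀ᶠ r in 𝓝 (‖z₀‖ ^ 2), deriv f r = deriv f (‖z₀‖ ^ 2) := by
    have hpow : ∀ᶠ r in 𝓝 (‖z₀‖ ^ 2), 0 < r ∧ deriv f r ^ n = c := by
      filter_upwards [hode, lt_mem_nhds hr0] with r h1 h2
      refine ⟨h2, ?_⟩
      rw [mul_pow, add_zero, mul_comm] at h1
      exact mul_right_cancel₀ (pow_ne_zero n h2.ne') h1
    filter_upwards [hpow, hpos] with r h1 h2
    exact (pow_left_inj₀ h2.le hpos.self_of_nhds.le (by omega)).1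
      (h1.2.trans hpow.self_of_nhds.2.symm)
  have hnorm : Tendsto (fun w : Cn n => ‖w‖ ^ 2) (𝓝 z₀) (𝓝 (‖z₀‖ ^ 2)) :=
    (continuous_norm.pow 2).tendsto z₀
  refine ⟨(deriv f (‖z₀‖ ^ 2) : ℝ), by exact_mod_cast hpos.self_of_nhds.ne', ?_⟩
  filter_upwards [hg, hnorm.eventually hconst.eventually_nhds,
    hnorm.eventually ((hf.of_le (m := 2) (by norm_cast)).eventually (by simp))] with w h1 h2 h3
  ext i j
  have h4 : deriv (deriv f) (‖w‖ ^ 2) = 0 := by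
    have : deriv f =ᶠ[𝓝 (‖w‖ ^ 2)] fun _ => deriv f (‖z₀‖ ^ 2) := h2
    rw [this.deriv_eq, deriv_const]
  rw [h1, complexHessian_radial h3, h4, h2.self_of_nhds]
  simp [Matrix.one_apply]

/-- If the curvature were nonzero somewhere, it would be nonzero on an open set, which meets a
radial chart away from its origin. -/
theorem KahlerMetric.isFlat_of_radial (g : KahlerMetric n M) (hn : 2 ≤ n) (hric : g.IsRicciFlat)
    (hrad : g.IsRadial) (hproj : g.IsProjectivelyInduced) : g.IsFlat := by
  intro ψ hψ z hz i j k l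
  have hzero : ∀ w ∈ ψ.target, ∀ φ ∈ holCharts n M, ψ.symm w ∈ φ.source → g.IsRadialIn φ →
      φ (ψ.symm w) ≠ 0 → g.curvature ψ w i j k l = 0 := by
    intro w hw φ hφ hwφ hφr hne
    obtain ⟨c, hc, hev⟩ := g.eventually_const_of_radial hn hric hproj hφ hφr
      (φ.map_source hwφ) hne
    exact g.curvature_eq_zero_of_eventually_const hφ hψ hw hwφ hc hev i j k l
  by_contra hcurv
  -- an open set on which the curvature does not vanish
  have hO : IsOpen (ψ.target ∩ (fun z => g.curvature ψ z i j k l) ⁻¹' {0}ᶜ) :=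
    (g.continuousOn_curvature hψ i j k l).isOpen_inter_preimage ψ.open_target
      isOpen_compl_singleton
  set O := ψ.target ∩ (fun z => g.curvature ψ z i j k l) ⁻¹' {0}ᶜ with hOdef
  have hO' : IsOpen (ψ.symm '' O) := ψ.symm.isOpen_image_of_subset_source hO inter_subset_left
  obtain ⟨p, hpO, φ, hφ, hpφ, hφr⟩ := hrad.inter_open_nonempty _ hO'
    ⟨ψ.symm z, mem_image_of_mem _ ⟨hz, hcurv⟩⟩
  have hO2 : IsOpen (φ '' (ψ.symm '' O ∩ φ.source)) :=
    φ.isOpen_image_of_subset_source (hO'.inter φ.open_source) inter_subset_right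
  have : NeZero n := ⟨by omega⟩
  have hnt : Nontrivial (Cn n) := by
    refine ⟨⟨0, basisVec 0, fun h => ?_⟩⟩
    simpa [basisVec] using congrArg (fun v : Cn n => v 0) h
  -- The radial analysis fails at the origin of φ; since `Cn n` has no isolated points, the open set
  -- contains another point.
  obtain ⟨y, ⟨_, ⟨⟨w, hw, rfl⟩, hwφ⟩, rfl⟩, hy0⟩ :=
    (dense_compl_singleton (0 : Cn n)).inter_open_nonempty _ hO2
      ⟨φ p, mem_image_of_mem _ ⟨hpO, hpφ⟩⟩
  exact hw.2 (hzero w hw.1 φ hφ hwφ hφr hy0)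

end RadialMetric

end KahlerGeom

theorem theorem1p1 (n : ℕ) (M : Type*) [TopologicalSpace M]
    [ChartedSpace (KahlerGeom.Cn n) M] [IsManifold 𝓘(ℂ, KahlerGeom.Cn n) ω M]
    (g : KahlerGeom.KahlerMetric n M)
    (hradial : g.IsRadial) (hricci : g.IsRicciFlat)
    (hstable : g.IsStableProjectivelyInduced) :
    g.IsFlat := by
  obtain ⟨ε, hε, h⟩ := hstable
  have hproj : g.IsProjectivelyInduced := by
    -- Stability at the factor 1 provides an immersion of g itself, once scaling by 1 is identified
    -- with the identity.
    obtain ⟨N, F, hF⟩ := h 1 ⟨by linarith, by linarith⟩ one_pos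
    refine ⟨N, F, fun p => ?_⟩
    obtain ⟨V, hV, hp, s, hs, hs0, hsg⟩ := hF p
    refine ⟨V, hV, hp, s, hs, hs0, fun φ hφ z hz hzV => ?_⟩
    rw [← hsg φ hφ z hz hzV]
    ext i j
    have := KahlerGeom.coeff_smul 1 g.form φ z i j
    rw [Complex.ofReal_one, one_mul] at this
    rw [← this]
    rfl
  rcases Nat.lt_or_ge n 2 with hn | hn
  · interval_cases n
    · intro φ hφ z hz i
      exact i.elim0
    · exact g.isFlat_of_dim_one hricci
  · exact g.isFlat_of_radial hn hricci hradial hproj
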